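/- Let $M$ be a smooth Riemannian manifold of dimension $n+1$ (no restriction on its curvature) with Levi-Civita connection $\overline\nabla$ and curvature tensor $\overline R(X,Y)Z=\overline\nabla_X\overline\nabla_YZ-\overline\nabla_Y\overline\nabla_XZ-\overline\nabla_{[X,Y]}Z$, let $\mathcal F$ be a smooth codimension-one foliation of $M$ with a smooth unit normal vector field $N$, and let $r\ge 0$ be an integer. On each leaf $L$, with $^\top$ the orthogonal projection onto $TL$, let $A(X)=-(\overline\nabla_XN)^\top$ be the shape operator, $S_k=\sigma_k(\kappa_1,\dots,\kappa_n)$ the $k$-th mean curvature (the $k$-th elementary symmetric function of the eigenvalues $\kappa_i$ of $A$, with $S_0=1$ and $S_k=0$ for $k>n$), and $T_0=I$, $T_k=S_kI-AT_{k-1}$ the Newton transformations. For a smooth function $f$ on $L$ put $$J_rf=\operatorname{Tr}(T_r\circ\operatorname{Hess}f)+\operatorname{Tr}(A^2T_r)\,f+\operatorname{Tr}(\overline R(N)T_r)\,f,\qquad \overline R(N)X=\overline R(X,N)N,$$ where $\operatorname{Hess}f$ is the Hessian of $f$ on $L$ with respect to the induced metric, and for normal fields put $J_r(fN)=J_r(f)N$.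 A smooth vector field $W$ on $M$ that is normal to $\mathcal F$ is called an $r$-th Jacobi field of $\mathcal F$ if $J_r(W)=0$ on every leaf. Suppose that all leaves of $\mathcal F$ have the same constant $(r+1)$-th mean curvature, i.e. there is a constant $c$ with $S_{r+1}=c$ on every leaf. If $V$ is a smooth vector field on $M$ that preserves $\mathcal F$, i.e. the (local) flow of $V$ maps leaves onto leaves, then its normal component $V^\perp=fN$, $f=\langle V,N\rangle$, is an $r$-th Jacobi field of $\mathcal F$. -/

import Mathlib

open Bundle Set
open scoped Manifold ContDiff Topology

set_option linter.unusedSectionVars false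

noncomputable section LeviCivita

variable {E : Type*} [NormedAddCommGroup E] [NormedSpace ℝ E] [FiniteDimensional ℝ E]
  {H : Type*} [TopologicalSpace H] {I : ModelWithCorners ℝ E H}
  {M : Type*} [TopologicalSpace M] [ChartedSpace H M] [IsManifold I ∞ M]
  [RiemannianBundle (fun x : M => TangentSpace I x)]
  [IsContMDiffRiemannianBundle I ∞ E (fun x : M => TangentSpace I x)]

instance tangentSpace_finiteDimensional (x : M) : FiniteDimensional ℝ (TangentSpace I x) :=
  inferInstanceAs (FiniteDimensional ℝ E)

theorem mdiffAt_inner {X Y : Π x : M, TangentSpace I x} {x : M}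
    (hX : MDiffAt (T% X) x) (hY : MDiffAt (T% Y) x) :
    MDiffAt (fun y => (inner ℝ (X y) (Y y) : ℝ)) x :=
  MDifferentiableAt.inner_bundle (E := fun x : M => TangentSpace I x) hX hY

variable (I) in
/-- Half of the right-hand side of the Koszul formula. -/
def koszul (Y X Z : Π x : M, TangentSpace I x) (x : M) : ℝ :=
  (1 / 2 : ℝ) * (mvfderiv I (fun y => (inner ℝ (Y y) (Z y) : ℝ)) x (X x)
    + mvfderiv I (fun y => (inner ℝ (Z y) (X y) : ℝ)) x (Y x)
    - mvfderiv I (fun y => (inner ℝ (X y) (Y y) : ℝ)) x (Z x)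
    + inner ℝ (VectorField.mlieBracket I X Y x) (Z x)
    - inner ℝ (VectorField.mlieBracket I X Z x) (Y x)
    - inner ℝ (VectorField.mlieBracket I Y Z x) (X x))

theorem mvfderiv_inner_smul {X Y : Π x : M, TangentSpace I x} {f : M → ℝ} {x : M}
    (hf : MDiffAt f x) (hX : MDiffAt (T% X) x) (hY : MDiffAt (T% Y) x) (v : TangentSpace I x) :
    mvfderiv I (fun y => (inner ℝ ((f • X) y) (Y y) : ℝ)) x v
      = f x * mvfderiv I (fun y => (inner ℝ (X y) (Y y) : ℝ)) x v
        + inner ℝ (X x) (Y x) * mvfderiv I f x v := by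
  have e2 : (fun y => (inner ℝ ((f • X) y) (Y y) : ℝ)) = f * fun y => (inner ℝ (X y) (Y y) : ℝ) := by
    ext y; simp [inner_smul_left]
  rw [e2, mvfderiv_mul hf (mdiffAt_inner hX hY)]
  simp

theorem mvfderiv_inner_add {X X' Y : Π x : M, TangentSpace I x} {x : M}
    (hX : MDiffAt (T% X) x) (hX' : MDiffAt (T% X') x)
    (hY : MDiffAt (T% Y) x) (v : TangentSpace I x) :
    mvfderiv I (fun y => (inner ℝ ((X + X') y) (Y y) : ℝ)) x v
      = mvfderiv I (fun y => (inner ℝ (X y) (Y y) : ℝ)) x v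
        + mvfderiv I (fun y => (inner ℝ (X' y) (Y y) : ℝ)) x v := by
  have e2 : (fun y => (inner ℝ ((X + X') y) (Y y) : ℝ))
      = (fun y => (inner ℝ (X y) (Y y) : ℝ)) + fun y => (inner ℝ (X' y) (Y y) : ℝ) := by
    ext y; simp [inner_add_left]
  rw [e2, mvfderiv_add (mdiffAt_inner hX hY) (mdiffAt_inner hX' hY)]
  simp

theorem mvfderiv_inner_comm (X Y : Π x : M, TangentSpace I x) :
    mvfderiv I (fun y => (inner ℝ (X y) (Y y) : ℝ))
      = mvfderiv I (fun y => (inner ℝ (Y y) (X y) : ℝ)) := by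
  simp only [real_inner_comm]

theorem koszul_tensorial_left {Y Z : Π x : M, TangentSpace I x} {x : M}
    (hY : MDiffAt (T% Y) x) (hZ : MDiffAt (T% Z) x) :
    TensorialAt I E (fun X => koszul I Y X Z x) x where
  smul {f X} hf hX := by
    simp only [koszul]
    rw [mvfderiv_inner_comm Z (f • X), mvfderiv_inner_comm Z X,
      mvfderiv_inner_smul hf hX hY, mvfderiv_inner_smul hf hX hZ,
      VectorField.mlieBracket_smul_left hf hX, VectorField.mlieBracket_smul_left hf hX]
    simp [inner_add_left, inner_smul_left, inner_smul_right, mvfderiv]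
    ring
  add {X X'} hX hX' := by
    simp only [koszul]
    rw [mvfderiv_inner_comm Z (X + X'), mvfderiv_inner_comm Z X, mvfderiv_inner_comm Z X',
      mvfderiv_inner_add hX hX' hY, mvfderiv_inner_add hX hX' hZ,
      VectorField.mlieBracket_add_left hX hX', VectorField.mlieBracket_add_left hX hX']
    simp [inner_add_left, inner_add_right]
    ring

theorem koszul_tensorial_right {Y X : Π x : M, TangentSpace I x} {x : M}
    (hY : MDiffAt (T% Y) x) (hX : MDiffAt (T% X) x) :
    TensorialAt I E (fun Z => koszul I Y X Z x) x where
  smul {f Z} hf hZ := by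
    simp only [koszul]
    rw [mvfderiv_inner_comm Y (f • Z), mvfderiv_inner_comm Y Z,
      mvfderiv_inner_smul hf hZ hX, mvfderiv_inner_smul hf hZ hY,
      VectorField.mlieBracket_smul_right hf hZ, VectorField.mlieBracket_smul_right hf hZ]
    simp [inner_add_left, inner_smul_left, inner_smul_right, mvfderiv]
    ring
  add {Z Z'} hZ hZ' := by
    simp only [koszul]
    rw [mvfderiv_inner_comm Y (Z + Z'), mvfderiv_inner_comm Y Z, mvfderiv_inner_comm Y Z',
      mvfderiv_inner_add hZ hZ' hX, mvfderiv_inner_add hZ hZ' hY,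
      VectorField.mlieBracket_add_right hZ hZ', VectorField.mlieBracket_add_right hZ hZ']
    simp [inner_add_left, inner_add_right]
    ring

open Classical in
variable (I) in
/-- The Levi-Civita derivative of the vector field `Y` at `x`, as the linear map `v ↦ ∇_v Y`. -/
def leviCivitaAux (Y : Π x : M, TangentSpace I x) (x : M) :
    TangentSpace I x →L[ℝ] TangentSpace I x :=
  if h : MDiffAt (T% Y) x then
    LinearMap.toContinuousLinearMap
      { toFun := fun v => (InnerProductSpace.toDual ℝ (TangentSpace I x)).symm
          (TensorialAt.mkHom₂ (fun X Z => koszul I Y X Z x) x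
            (fun _ hZ => koszul_tensorial_left h hZ) (fun _ hX => koszul_tensorial_right h hX) v)
        map_add' := fun v w => by rw [map_add, map_add]
        map_smul' := fun c v => by rw [map_smul, LinearIsometryEquiv.map_smulₛₗ]; simp }
  else 0

theorem inner_leviCivitaAux {Y X Z : Π x : M, TangentSpace I x} {x : M}
    (hY : MDiffAt (T% Y) x) (hX : MDiffAt (T% X) x) (hZ : MDiffAt (T% Z) x) :
    inner ℝ (leviCivitaAux I Y x (X x)) (Z x) = koszul I Y X Z x := by
  rw [leviCivitaAux, dif_pos hY]
  simp only [LinearMap.coe_toContinuousLinearMap', LinearMap.coe_mk, AddHom.coe_mk,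
    InnerProductSpace.toDual_symm_apply]
  rw [TensorialAt.mkHom₂_apply _ _ hX hZ]

theorem leviCivitaAux_ext {x : M} {A B : TangentSpace I x →L[ℝ] TangentSpace I x}
    (h : ∀ X Z : Π x : M, TangentSpace I x, MDiffAt (T% X) x → MDiffAt (T% Z) x →
      (inner ℝ (A (X x)) (Z x) : ℝ) = inner ℝ (B (X x)) (Z x)) : A = B := by
  ext v
  refine ext_inner_right ℝ fun w => ?_
  have := h (FiberBundle.extend E v) (FiberBundle.extend E w)
    (FiberBundle.mdifferentiableAt_extend ..) (FiberBundle.mdifferentiableAt_extend ..)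
  simpa using this

variable (I M) in
/-- The Levi-Civita connection of a Riemannian manifold, given by the Koszul formula. -/
def leviCivita : CovariantDerivative I E (fun x : M => TangentSpace I x) where
  toFun := leviCivitaAux I
  isCovariantDerivativeOnUniv :=
    { add := by
        intro Y Y' x hY hY' _
        refine leviCivitaAux_ext fun X Z hX hZ => ?_
        have hYY' : MDiffAt (T% (Y + Y')) x := mdifferentiableAt_add_section hY hY'
        rw [add_apply, inner_add_left, inner_leviCivitaAux hYY' hX hZ,
          inner_leviCivitaAux hY hX hZ, inner_leviCivitaAux hY' hX hZ]
        simp only [koszul]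
        rw [mvfderiv_inner_comm X (Y + Y'), mvfderiv_inner_comm X Y, mvfderiv_inner_comm X Y',
          mvfderiv_inner_add hY hY' hZ, mvfderiv_inner_add hY hY' hX,
          VectorField.mlieBracket_add_left hY hY', VectorField.mlieBracket_add_right hY hY']
        simp [inner_add_left, inner_add_right]
        ring
      leibniz := by
        intro Y f x hY hf _
        refine leviCivitaAux_ext fun X Z hX hZ => ?_
        have hfY : MDiffAt (T% (f • Y)) x := hf.smul_section hY
        rw [add_apply, inner_add_left, inner_leviCivitaAux hfY hX hZ,
          smul_apply, inner_smul_left, inner_leviCivitaAux hY hX hZ]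
        simp only [koszul]
        rw [mvfderiv_inner_comm X (f • Y), mvfderiv_inner_comm X Y,
          mvfderiv_inner_smul hf hY hZ, mvfderiv_inner_smul hf hY hX,
          VectorField.mlieBracket_smul_left hf hY, VectorField.mlieBracket_smul_right hf hY]
        simp [inner_add_left, inner_smul_left, inner_smul_right, mvfderiv]
        rw [real_inner_comm (X x) (Z x)]
        ring }

theorem inner_leviCivita {Y X Z : Π x : M, TangentSpace I x} {x : M}
    (hY : MDiffAt (T% Y) x) (hX : MDiffAt (T% X) x) (hZ : MDiffAt (T% Z) x) :
    inner ℝ (leviCivita I M Y x (X x)) (Z x) = koszul I Y X Z x :=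
  inner_leviCivitaAux hY hX hZ

theorem leviCivita_torsion : (leviCivita I M).torsion = 0 := by
  rw [CovariantDerivative.torsion_eq_zero_iff]
  intro X Y x hX hY
  refine ext_inner_right ℝ fun w => ?_
  have hZ : MDiffAt (T% (FiberBundle.extend E w : Π x : M, TangentSpace I x)) x :=
    FiberBundle.mdifferentiableAt_extend ..
  have e : (FiberBundle.extend E w : Π x : M, TangentSpace I x) x = w := by simp
  rw [inner_sub_left, ← e, inner_leviCivita hY hX hZ, inner_leviCivita hX hY hZ]
  simp only [koszul]
  rw [mvfderiv_inner_comm X Y, mvfderiv_inner_comm Y (FiberBundle.extend E w),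
    mvfderiv_inner_comm X (FiberBundle.extend E w), VectorField.mlieBracket_swap (V := Y) (W := X)]
  simp
  ring

theorem leviCivita_metric {X Y Z : Π x : M, TangentSpace I x} {x : M}
    (hX : MDiffAt (T% X) x) (hY : MDiffAt (T% Y) x) (hZ : MDiffAt (T% Z) x) :
    mvfderiv I (fun y => (inner ℝ (Y y) (Z y) : ℝ)) x (X x)
      = inner ℝ (leviCivita I M Y x (X x)) (Z x) + inner ℝ (Y x) (leviCivita I M Z x (X x)) := by
  rw [real_inner_comm _ (Y x), inner_leviCivita hY hX hZ, inner_leviCivita hZ hX hY]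
  simp only [koszul]
  rw [mvfderiv_inner_comm Z Y, mvfderiv_inner_comm X Y, mvfderiv_inner_comm Z X,
    VectorField.mlieBracket_swap (V := Z) (W := Y)]
  simp
  ring

variable (I) in
/-- The curvature `R(X, Y)Z = ∇_X ∇_Y Z - ∇_Y ∇_X Z - ∇_[X, Y] Z` of the Levi-Civita connection. -/
def riemannCurvature (X Y Z : Π x : M, TangentSpace I x) (x : M) : TangentSpace I x :=
  leviCivita I M (fun y => leviCivita I M Z y (Y y)) x (X x)
    - leviCivita I M (fun y => leviCivita I M Z y (X y)) x (Y x)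
    - leviCivita I M Z x (VectorField.mlieBracket I X Y x)

end LeviCivita

/-- A smooth codimension-one foliation of an `(n + 1)`-manifold `M`, given by a foliated atlas:
smooth charts that cover `M` and whose plaques are the level sets of the last coordinate. Under a
change of foliated charts the new last coordinate is locally a function of the old one alone. -/
structure CodimOneFoliation (n : ℕ) (M : Type*) [TopologicalSpace M]
    [ChartedSpace (EuclideanSpace ℝ (Fin (n + 1))) M] where
  /-- the foliated charts -/
  atlas : Set (OpenPartialHomeomorph M (EuclideanSpace ℝ (Fin (n + 1))))
  smooth : ∀ e ∈ atlas, e ∈ IsManifold.maximalAtlas (𝓡 (n + 1)) ∞ M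
  cover : ∀ x, ∃ e ∈ atlas, x ∈ e.source
  compatible : ∀ e ∈ atlas, ∀ e' ∈ atlas, ∀ x ∈ e.source ∩ e'.source,
    ∃ h : ℝ → ℝ, ∀ᶠ y in 𝓝 x, e' y (Fin.last n) = h (e y (Fin.last n))

namespace CodimOneFoliation

noncomputable section

section Leaves

variable {n : ℕ} {M : Type*} [TopologicalSpace M]
  [ChartedSpace (EuclideanSpace ℝ (Fin (n + 1))) M] (F : CodimOneFoliation n M)

/-- A continuous curve lies in one leaf if in every foliated chart its last coordinate is locally
constant, i.e. it stays locally in one plaque. -/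
def IsLeafCurve (c : unitInterval → M) : Prop :=
  Continuous c ∧ ∀ s, ∀ e ∈ F.atlas, c s ∈ e.source →
    ∀ᶠ s' in 𝓝 s, e (c s') (Fin.last n) = e (c s) (Fin.last n)

/-- The leaf through `x`. -/
def leaf (x : M) : Set M := {y | ∃ c, F.IsLeafCurve c ∧ c 0 = x ∧ c 1 = y}

/-- `L` is a leaf of the foliation. -/
def IsLeaf (L : Set M) : Prop := ∃ x, L = F.leaf x

/-- The tangent space at `x` of the leaf through `x`. -/
def tangent (x : M) : Submodule ℝ (TangentSpace (𝓡 (n + 1)) x) :=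
  ⨅ e ∈ {e ∈ F.atlas | x ∈ e.source},
    LinearMap.ker (mvfderiv (𝓡 (n + 1)) (fun y => e y (Fin.last n)) x).toLinearMap

/-- The (local) flow of `V` maps leaves onto leaves: if a curve `s ↦ Φ s 0` inside a leaf is moved
for the time `T` (of either sign) by the flow of `V`, then its end points are again in one leaf.
If `V` is complete, with flow `φ`, this says that points `x, y` of a leaf have
`φ_T x, φ_T y` in one leaf, for all `T`; so `φ_T` maps every leaf onto a leaf. -/
def PreservedBy (V : Π x : M, TangentSpace (𝓡 (n + 1)) x) : Prop :=
  ∀ (T : ℝ) (Φ : unitInterval → ℝ → M),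
    ContinuousOn (fun q : unitInterval × ℝ => Φ q.1 q.2) (univ ×ˢ uIcc 0 T) →
    F.IsLeafCurve (fun s => Φ s 0) →
    (∀ s, IsMIntegralCurveOn (Φ s) V (uIcc 0 T)) →
    ∃ L, F.IsLeaf L ∧ Φ 0 T ∈ L ∧ Φ 1 T ∈ L

end Leaves

variable {n : ℕ} {M : Type*} [TopologicalSpace M]
  [ChartedSpace (EuclideanSpace ℝ (Fin (n + 1))) M] [IsManifold (𝓡 (n + 1)) ∞ M]
  [RiemannianBundle (fun x : M => TangentSpace (𝓡 (n + 1)) x)]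
  [IsContMDiffRiemannianBundle (𝓡 (n + 1)) ∞ (EuclideanSpace ℝ (Fin (n + 1)))
    (fun x : M => TangentSpace (𝓡 (n + 1)) x)]
  (F : CodimOneFoliation n M)

instance (x : M) : CompleteSpace (F.tangent x) := FiniteDimensional.complete ℝ _

/-- `N` is a smooth unit normal vector field of the foliation. -/
structure IsUnitNormal (N : Π x : M, TangentSpace (𝓡 (n + 1)) x) : Prop where
  smooth : ContMDiff (𝓡 (n + 1)) (𝓡 (n + 1)).tangent ∞ (T% N)
  norm_eq_one : ∀ x, ‖N x‖ = 1
  normal : ∀ x, N x ∈ (F.tangent x)ᗮ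

/-- The orthogonal projection `v ↦ v^⊤` onto the tangent space of the leaf. -/
def tangentPart (x : M) : TangentSpace (𝓡 (n + 1)) x →ₗ[ℝ] F.tangent x :=
  (F.tangent x).orthogonalProjectionOnto.toLinearMap

/-- The component `V^⊥` of `V` orthogonal to the leaves. -/
def normalPart (V : Π x : M, TangentSpace (𝓡 (n + 1)) x) (x : M) : TangentSpace (𝓡 (n + 1)) x :=
  V x - F.tangentPart x (V x)

section Operators

variable (N : Π x : M, TangentSpace (𝓡 (n + 1)) x)

/-- The shape operator `A(v) = -(∇_v N)^⊤` of the leaf through `x`, at `x`. -/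
def shape (x : M) : F.tangent x →ₗ[ℝ] F.tangent x :=
  -(F.tangentPart x ∘ₗ (leviCivita (𝓡 (n + 1)) M N x).toLinearMap ∘ₗ (F.tangent x).subtype)

/-- The `r`-th mean curvature `S_r(x) = σ_r(κ_1, …, κ_n)` of the leaf through `x`: the `r`-th
elementary symmetric function of the eigenvalues of the shape operator, with multiplicity. -/
def meanCurvature (r : ℕ) (x : M) : ℝ := (F.shape N x).charpoly.roots.esymm r

/-- The Newton transformations: `T_0 = I` and `T_r = S_r I - A T_{r-1}`. -/
def newton (x : M) : ℕ → (F.tangent x →ₗ[ℝ] F.tangent x)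
  | 0 => LinearMap.id
  | r + 1 => F.meanCurvature N (r + 1) x • LinearMap.id - F.shape N x ∘ₗ newton x r

/-- The gradient at `x` of the restriction of `f` to the leaf through `x`. -/
def leafGradient (f : M → ℝ) (x : M) : F.tangent x :=
  (InnerProductSpace.toDual ℝ (F.tangent x)).symm
    (LinearMap.toContinuousLinearMap
      ((mvfderiv (𝓡 (n + 1)) f x).toLinearMap ∘ₗ (F.tangent x).subtype))

/-- The Hessian `v ↦ ∇_v(∇f)` at `x` of the restriction of `f` to the leaf through `x`; the
connection of the leaf is the tangential part of the connection of `M`. -/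
def leafHessian (f : M → ℝ) (x : M) : F.tangent x →ₗ[ℝ] F.tangent x :=
  F.tangentPart x ∘ₗ
    (leviCivita (𝓡 (n + 1)) M (fun y => (F.leafGradient f y : TangentSpace (𝓡 (n + 1)) y))
      x).toLinearMap ∘ₗ (F.tangent x).subtype

/-- `Tr(R(N) T_r)` at `x`, where `R(N)v = R(v, N)N`: the sum of `⟨R(T_r e_i, N)N, e_i⟩` over an
orthonormal basis `e_i` of the tangent space of the leaf. -/
def traceCurvature (r : ℕ) (x : M) : ℝ :=
  ∑ i, inner ℝ (riemannCurvature (𝓡 (n + 1))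
      (FiberBundle.extend (EuclideanSpace ℝ (Fin (n + 1)))
        (F.newton N x r (stdOrthonormalBasis ℝ (F.tangent x) i) : TangentSpace (𝓡 (n + 1)) x))
      N N x)
    (stdOrthonormalBasis ℝ (F.tangent x) i : TangentSpace (𝓡 (n + 1)) x)

/-- The operator `L_r f = Tr(T_r ∘ Hess f)` on the leaves. -/
def opL (r : ℕ) (f : M → ℝ) (x : M) : ℝ :=
  LinearMap.trace ℝ (F.tangent x) (F.newton N x r ∘ₗ F.leafHessian f x)

/-- The operator `J_r f = L_r f + Tr(A² T_r) f + Tr(R(N) T_r) f` on the leaves. -/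
def opJ (r : ℕ) (f : M → ℝ) (x : M) : ℝ :=
  F.opL N r f x
    + LinearMap.trace ℝ (F.tangent x) (F.shape N x ∘ₗ F.shape N x ∘ₗ F.newton N x r) * f x
    + F.traceCurvature N r x * f x

/-- The operator `J_r(f N) = J_r(f) N` on normal vector fields `W = f N`, `f = ⟨W, N⟩`. -/
def normalJ (r : ℕ) (W : Π x : M, TangentSpace (𝓡 (n + 1)) x) (x : M) :
    TangentSpace (𝓡 (n + 1)) x :=
  F.opJ N r (fun y => inner ℝ (W y) (N y)) x • N x

/-- The smooth normal field `W` is an `r`-th Jacobi field of the foliation: `J_r(W) = 0` on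
each leaf. -/
structure IsJacobiField (r : ℕ) (W : Π x : M, TangentSpace (𝓡 (n + 1)) x) : Prop where
  smooth : ContMDiff (𝓡 (n + 1)) (𝓡 (n + 1)).tangent ∞ (T% W)
  normal : ∀ x, W x ∈ (F.tangent x)ᗮ
  eq_zero : ∀ L, F.IsLeaf L → ∀ x ∈ L, F.normalJ N r W x = 0

end Operators

end

end CodimOneFoliation

/-! Put `f = ⟨V, N⟩` and `W = V^⊥ = f N`. The theorem is the infinitesimal form of one observation:
moving the leaves along `W` moves leaves to leaves, so the first variation of `S_{r+1}` in this
direction is an honest derivative of a function on `M`. That variation is `J_r f`, so `J_r f =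
W(S_{r+1})`, which vanishes when `S_{r+1}` is constant.

Since `V` preserves the foliation, `[W, X]` is tangent for every tangent `X`
(`PreservedBy.mlieBracket_normalPart_mem`). Pairing this with `N` gives `grad f = -f ∇_N N` along
the leaves (`PreservedBy.coe_leafGradient`). Substituting the gradient, the torsion-free identity
and the definition of curvature give, after tangential projection, `L_W A = Hess f + f A² + f R(N)`
(`PreservedBy.lieDerivative_shape_tangentPart`).

In a tangent frame `X_j` where `A` has matrix `c`, the same Lie derivative is `W(c) + D A - A D`,
with `D` sending `X_j` to `[W, X_j]` (`PreservedBy.exists_commutator`). Multiply by `T_r` and take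
traces. The commutator disappears because `T_r` commutes with `A`, and `Tr(T_r W(c)) = W(S_{r+1})`
because the differential of `σ_{r+1}` at `C` is `B ↦ Tr(T_r B)` (`Matrix.hasDerivAt_eigenEsymm`).
This is `PreservedBy.opJ_eq_mvfderiv_meanCurvature`.

The remaining gap is that preservation is assumed for leaves, which are global and may return to a
chart infinitely often, while the argument needs an infinitesimal statement in one chart. Second
countability closes it: a leaf meets a chart in countably many plaques, so the last coordinate of a
connected piece of a leaf cannot vary (`countable_lastCoord_of_mem_leaf`,
`PreservedBy.mvfderiv_mvfderiv_lastCoord`). -/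

namespace Matrix

/-! ### Elementary symmetric functions of eigenvalues and Newton transformations of matrices -/

open Polynomial

variable {ι : Type*} [Fintype ι] [DecidableEq ι]

/-- The `k`-th elementary symmetric function of the eigenvalues of a matrix, as a signed
coefficient of its characteristic polynomial. -/
noncomputable def eigenEsymm {R : Type*} [CommRing R] (C : Matrix ι ι R) (k : ℕ) : R :=
  (-1) ^ k * C.charpolyRev.coeff k

/-- The Newton transformations of a matrix. -/
noncomputable def newtonTransform {R : Type*} [CommRing R] (C : Matrix ι ι R) : ℕ → Matrix ι ι R
  | 0 => 1
  | k + 1 => C.eigenEsymm (k + 1) • 1 - C * newtonTransform C k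

theorem commute_newtonTransform {R : Type*} [CommRing R] (C : Matrix ι ι R) (k : ℕ) :
    Commute C (C.newtonTransform k) := by
  induction k with
  | zero => exact Commute.one_right C
  | succ k ih =>
    exact ((Commute.one_right C).smul_right _).sub_right ((Commute.refl C).mul_right ih)

/-- Vieta's formulas, with the coefficient index reflected by the reversal of the polynomial.
Splitting guarantees that no eigenvalue is missing from the real roots. The form on the right is
polynomial in the entries and can be differentiated. -/
theorem charpoly_roots_esymm {C : Matrix ι ι ℝ} (h : C.charpoly.Splits) (k : ℕ) :
    C.charpoly.roots.esymm k = C.eigenEsymm k := by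
  have hcard : Multiset.card C.charpoly.roots = Fintype.card ι := by
    rw [← h.natDegree_eq_card_roots, charpoly_natDegree_eq_dim]
  rw [eigenEsymm, ← reverse_charpoly, coeff_reverse, charpoly_natDegree_eq_dim]
  rcases le_or_gt k (Fintype.card ι) with hk | hk
  · rw [revAt_le hk, coeff_eq_esymm_roots_of_splits h
      (by rw [charpoly_natDegree_eq_dim]; omega), charpoly_natDegree_eq_dim,
      (charpoly_monic C).leadingCoeff, one_mul, Nat.sub_sub_self hk, ← mul_assoc, ← pow_add,
      ← two_mul, pow_mul]
    simp
  · rw [revAt_eq_self_of_lt hk, coeff_eq_zero_of_natDegree_lt (by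
      rwa [charpoly_natDegree_eq_dim]), mul_zero, Multiset.esymm,
      Multiset.powersetCard_eq_empty _ (by rwa [hcard])]
    simp

/-- Comparing coefficients in `(1 - X C) Q = det(1 - X C)`, where `Q` is the adjugate, yields the
Newton recursion up to the sign `(-1)^k`. So `Q` is a generating function of the Newton
transformations. -/
theorem newtonTransform_eq_coeff_adjugate {R : Type*} [CommRing R] (C : Matrix ι ι R) (k : ℕ) :
    C.newtonTransform k
      = (-1 : R) ^ k • (adjugate (1 - (X : R[X]) • C.map Polynomial.C)).map (coeff · k) := by
  set Q := adjugate (1 - (X : R[X]) • C.map Polynomial.C) with hQ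
  have key : Q = C.charpolyRev • (1 : Matrix ι ι R[X]) + (X : R[X]) • (C.map Polynomial.C * Q) := by
    have h := mul_adjugate (1 - (X : R[X]) • C.map Polynomial.C)
    rw [← hQ, sub_mul, one_mul, smul_mul_assoc] at h
    rw [charpolyRev, ← h]
    abel
  have hcoeff : ∀ (i j : ι) (k : ℕ), (Q i j).coeff (k + 1)
      = C.charpolyRev.coeff (k + 1) * (1 : Matrix ι ι R) i j
        + (C * Q.map (coeff · k)) i j := by
    intro i j k
    rw [congrFun (congrFun key i) j]
    simp only [add_apply, smul_apply, smul_eq_mul, mul_apply, map_apply, coeff_add,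
      coeff_X_mul, finsetSum_coeff, coeff_C_mul]
    congr 1
    by_cases h : i = j <;> simp [h, one_apply]
  induction k with
  | zero =>
    ext i j
    have h0 : C.charpolyRev.coeff 0 = 1 := by
      rw [coeff_zero_eq_eval_zero, eval_charpolyRev]
    simp only [newtonTransform, pow_zero, one_smul, map_apply]
    rw [congrFun (congrFun key i) j]
    simp only [add_apply, smul_apply, smul_eq_mul, coeff_add, mul_coeff_zero, coeff_X_zero,
      zero_mul, add_zero, h0, one_mul]
    by_cases h : i = j <;> simp [h, one_apply]
  | succ k ih =>
    ext i j
    rw [newtonTransform, ih]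
    simp only [sub_apply, smul_apply, smul_eq_mul, map_apply, hcoeff, eigenEsymm, mul_smul_comm]
    ring

/-- Jacobi's formula. By Cramer's rule the trace is the sum of the determinants of `P` with one
column replaced by that of `Q`; the Leibniz expansion of this sum is the product rule applied to
that of the determinant. -/
theorem hasDerivAt_det_add_smul (P Q : Matrix ι ι ℝ) :
    HasDerivAt (fun s : ℝ => (P + s • Q).det) ((adjugate P * Q).trace) 0 := by
  have htr : (adjugate P * Q).trace = ∑ σ : Equiv.Perm ι, (Equiv.Perm.sign σ : ℤ) •
      ∑ i, (∏ j ∈ Finset.univ.erase i, P (σ j) j) * Q (σ i) i := by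
    have h1 : (adjugate P * Q).trace = ∑ i, (P.updateCol i (Q.col i)).det := by
      refine Finset.sum_congr rfl fun i _ => ?_
      rw [← cramer_apply, cramer_eq_adjugate_mulVec]
      rfl
    rw [h1]
    simp only [det_apply, Finset.smul_sum]
    rw [Finset.sum_comm]
    refine Finset.sum_congr rfl fun σ _ => Finset.sum_congr rfl fun i _ => ?_
    rw [← Finset.prod_erase_mul _ _ (Finset.mem_univ i)]
    congr 2
    · exact Finset.prod_congr rfl fun j hj => by simp [Finset.ne_of_mem_erase hj]
    · simp
  rw [htr]
  simp only [det_apply]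
  refine HasDerivAt.fun_sum fun σ _ => ?_
  have h : HasDerivAt (fun s : ℝ => ∏ i, (P + s • Q) (σ i) i)
      (∑ i, (∏ j ∈ Finset.univ.erase i, (P + (0 : ℝ) • Q) (σ j) j) • Q (σ i) i) 0 := by
    refine HasDerivAt.fun_finsetProd fun i _ => ?_
    simpa using ((hasDerivAt_id (0 : ℝ)).mul_const (Q (σ i) i)).const_add (P (σ i) i)
  have := h.const_mul ((Equiv.Perm.sign σ : ℤ) : ℝ)
  simpa [Units.smul_def] using this

theorem differentiable_det {κ : Type*} [Fintype κ] [DecidableEq κ] :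
    Differentiable ℝ (fun A : κ → κ → ℝ => (Matrix.of A).det) := by
  simp only [det_apply, of_apply, Units.smul_def, zsmul_eq_mul]
  fun_prop

/-- The coefficient is a sum of principal minors of `-A`, hence polynomial in the entries. -/
theorem differentiable_coeff_charpolyRev (k : ℕ) :
    Differentiable ℝ (fun A : ι → ι → ℝ => (Matrix.of A).charpolyRev.coeff k) := by
  have h : ∀ A : ι → ι → ℝ, (Matrix.of A).charpolyRev.coeff k
      = ∑ s ∈ Finset.univ.powersetCard k, ((-Matrix.of A).submatrix
        (Subtype.val : s → ι) (Subtype.val : s → ι)).det := by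
    intro A
    rw [← coeff_det_one_add_X_smul_eq_sum_minors, charpolyRev, Matrix.map_neg, smul_neg,
      sub_eq_add_neg]
    exact fun a => map_neg _ a
  simp only [h]
  refine Differentiable.fun_sum fun s _ => ?_
  exact differentiable_det.comp
    (f := fun (A : ι → ι → ℝ) (i j : (s : Finset ι)) => -A i j) (by fun_prop)

theorem differentiable_eigenEsymm (k : ℕ) :
    Differentiable ℝ (fun A : ι → ι → ℝ => (Matrix.of A).eigenEsymm k) :=
  (differentiable_coeff_charpolyRev k).const_mul _

/-- For fixed `t`, Jacobi's formula differentiates `det(1 - t(C + sB))` in `s`. Both ways of writing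
the result are polynomials in `t`, so their coefficients agree; the factor `t` in front of `B`
shifts the index from `k + 1` to `k`. -/
theorem hasDerivAt_coeff_charpolyRev (C B : Matrix ι ι ℝ) (k : ℕ) :
    HasDerivAt (fun s : ℝ => (C + s • B).charpolyRev.coeff (k + 1))
      (-((adjugate (1 - (X : ℝ[X]) • C.map Polynomial.C)).map (coeff · k) * B).trace) 0 := by
  set Q := adjugate (1 - (X : ℝ[X]) • C.map Polynomial.C) with hQ
  have hd : ∀ k, DifferentiableAt ℝ (fun s : ℝ => (C + s • B).charpolyRev.coeff k) 0 := fun k =>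
    ((differentiable_coeff_charpolyRev k).comp
      (f := fun (s : ℝ) (i j : ι) => C i j + s * B i j) (by fun_prop)).differentiableAt
  have hdeg : ∀ A : Matrix ι ι ℝ, A.charpolyRev.natDegree < Fintype.card ι + 1 := fun A => by
    rw [← reverse_charpoly, Nat.lt_succ_iff]
    exact (reverse_natDegree_le _).trans (charpoly_natDegree_eq_dim A).le
  have heval : ∀ (A : Matrix ι ι ℝ) (t : ℝ), A.charpolyRev.eval t = (1 - t • A).det := by
    intro A t
    rw [charpolyRev, ← coe_evalRingHom, RingHom.map_det]
    congr 1
    ext i j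
    by_cases h : i = j <;> simp [h, mul_comm t]
  have hevalQ : ∀ t : ℝ, (adjugate (1 - t • C)) = Q.map (eval t) := by
    intro t
    have := RingHom.map_adjugate (evalRingHom t) (1 - (X : ℝ[X]) • C.map Polynomial.C)
    rw [← hQ] at this
    refine Eq.trans ?_ this.symm
    congr 1
    ext i j
    by_cases h : i = j <;> simp [h, mul_comm t]
  set d : ℕ → ℝ := fun k => deriv (fun s : ℝ => (C + s • B).charpolyRev.coeff k) 0 with hdd
  let p : ℝ[X] := ∑ k ∈ Finset.range (Fintype.card ι + 1), Polynomial.C (d k) * X ^ k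
  let q : ℝ[X] := -X * (Q * B.map Polynomial.C).trace
  have hpq : p = q := by
    refine Polynomial.funext fun t => ?_
    have h1 : HasDerivAt (fun s : ℝ => (1 - t • (C + s • B)).det)
        ((adjugate (1 - t • C) * (-t • B)).trace) 0 := by
      convert hasDerivAt_det_add_smul (1 - t • C) (-t • B) using 3 with s
      rw [smul_add, smul_smul, smul_smul, mul_comm t s]
      simp only [mul_neg, neg_smul]
      abel
    have h2 : HasDerivAt (fun s : ℝ => (1 - t • (C + s • B)).det)
        (∑ k ∈ Finset.range (Fintype.card ι + 1), d k * t ^ k) 0 := by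
      have : (fun s : ℝ => (1 - t • (C + s • B)).det) = fun s =>
          ∑ k ∈ Finset.range (Fintype.card ι + 1), (C + s • B).charpolyRev.coeff k * t ^ k := by
        ext s
        rw [← heval, eval_eq_sum_range' (hdeg _)]
      rw [this]
      exact HasDerivAt.fun_sum fun k _ => (hd k).hasDerivAt.mul_const _
    have h3 := h2.unique h1
    simp only [p, q, eval_finsetSum, eval_mul, eval_C, eval_pow, eval_X, eval_neg]
    rw [h3, hevalQ, mul_smul_comm, trace_smul, smul_eq_mul]
    congr 1
    simp [trace, mul_apply, eval_finsetSum]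
  have hk : d (k + 1) = -(Q.map (coeff · k) * B).trace := by
    have hp : p.coeff (k + 1) = d (k + 1) := by
      simp only [p, finsetSum_coeff, coeff_C_mul, coeff_X_pow]
      -- Beyond the dimension the coefficient vanishes identically in `s`, so its derivative agrees
      -- with the absent coefficient of `p`.
      by_cases hk : k + 1 < Fintype.card ι + 1
      · rw [Finset.sum_eq_single (k + 1)] <;> simp +contextual [eq_comm]
        omega
      · rw [Finset.sum_eq_zero]
        · have : (fun s : ℝ => (C + s • B).charpolyRev.coeff (k + 1)) = fun _ => 0 := by
            ext s
            exact coeff_eq_zero_of_natDegree_lt (by have := hdeg (C + s • B); omega)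
          simp only [hdd]
          rw [this, deriv_const]
        · intro j hj
          rw [if_neg (by have := Finset.mem_range.1 hj; omega), mul_zero]
    rw [← hp, hpq]
    simp [q, trace, mul_apply, finsetSum_coeff]
  rw [← hk]
  exact (hd (k + 1)).hasDerivAt

/-- The derivative of `σ_{k+1}` at `C` in the direction `B` is the trace of `T_k B`. -/
theorem hasDerivAt_eigenEsymm (C B : Matrix ι ι ℝ) (k : ℕ) :
    HasDerivAt (fun s : ℝ => (C + s • B).eigenEsymm (k + 1))
      ((C.newtonTransform k * B).trace) 0 := by
  have := (hasDerivAt_coeff_charpolyRev C B k).const_mul ((-1) ^ (k + 1) : ℝ)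
  rw [newtonTransform_eq_coeff_adjugate, smul_mul_assoc, trace_smul, smul_eq_mul]
  rwa [mul_neg, ← neg_mul, pow_succ, mul_neg_one, neg_neg, ← mul_neg_one, ← pow_succ] at this

theorem fderiv_eigenEsymm (C B : ι → ι → ℝ) (k : ℕ) :
    fderiv ℝ (fun A : ι → ι → ℝ => (Matrix.of A).eigenEsymm (k + 1)) C B
      = ((of C).newtonTransform k * of B).trace := by
  have h : HasFDerivAt (fun A : ι → ι → ℝ => (Matrix.of A).eigenEsymm (k + 1))
      (fderiv ℝ (fun A : ι → ι → ℝ => (Matrix.of A).eigenEsymm (k + 1)) C)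
      ((fun s : ℝ => C + s • B) 0) := by
    simpa using ((differentiable_eigenEsymm (k + 1)) C).hasFDerivAt
  have h2 : HasDerivAt (fun s : ℝ => C + s • B) B 0 := by
    simpa using ((hasDerivAt_id (0 : ℝ)).smul_const B).const_add C
  exact (h.comp_hasDerivAt (0 : ℝ) h2).unique (hasDerivAt_eigenEsymm (of C) (of B) k)

end Matrix

/-! ### Differentiability of finite families, determinants and directional derivatives -/

section Differentiability

variable {E : Type*} [NormedAddCommGroup E] [NormedSpace ℝ E]
  {H : Type*} [TopologicalSpace H] {I : ModelWithCorners ℝ E H}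
  {M : Type*} [TopologicalSpace M] [ChartedSpace H M]

theorem mdifferentiableAt_pi {κ : Type*} [Fintype κ] {F : κ → Type*}
    [∀ i, NormedAddCommGroup (F i)] [∀ i, NormedSpace ℝ (F i)] {f : ∀ i, M → F i} {x : M}
    (hf : ∀ i, MDifferentiableAt I 𝓘(ℝ, F i) (f i) x) :
    MDifferentiableAt I 𝓘(ℝ, ∀ i, F i) (fun y i => f i y) x := by
  rw [mdifferentiableAt_iff]
  refine ⟨continuousAt_pi.2 fun i => (hf i).continuousAt, ?_⟩
  rw [differentiableWithinAt_pi]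
  intro i
  exact ((mdifferentiableAt_iff _ _).1 (hf i)).2

theorem mvfderiv_differentiable_comp {F F' : Type*} [NormedAddCommGroup F] [NormedSpace ℝ F]
    [NormedAddCommGroup F'] [NormedSpace ℝ F'] {g : F → F'} {f : M → F} {x : M}
    (hg : DifferentiableAt ℝ g (f x)) (hf : MDifferentiableAt I 𝓘(ℝ, F) f x)
    (v : TangentSpace I x) :
    mvfderiv I (fun y => g (f y)) x v = fderiv ℝ g (f x) (mvfderiv I f x v) := by
  have h : HasMFDerivAt I 𝓘(ℝ, F') (fun y => g (f y)) x
      ((fderiv ℝ g (f x)).comp (mfderiv I 𝓘(ℝ, F) f x)) :=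
    hg.hasFDerivAt.hasMFDerivAt.comp x hf.hasMFDerivAt
  simp only [mvfderiv, h.mfderiv]
  rfl

theorem mvfderiv_pi {κ : Type*} [Fintype κ] {F : κ → Type*}
    [∀ i, NormedAddCommGroup (F i)] [∀ i, NormedSpace ℝ (F i)] {f : ∀ i, M → F i} {x : M}
    (hf : ∀ i, MDifferentiableAt I 𝓘(ℝ, F i) (f i) x) (v : TangentSpace I x) (i : κ) :
    mvfderiv I (fun y i => f i y) x v i = mvfderiv I (f i) x v := by
  have h := mvfderiv_differentiable_comp (g := fun a : ∀ i, F i => a i) (f := fun y i => f i y)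
    (differentiableAt_apply i _) (mdifferentiableAt_pi hf) v
  rw [(hasFDerivAt_apply i (fun i => f i x)).fderiv] at h
  exact h.symm

theorem Matrix.mdifferentiableAt_det {κ : Type*} [Fintype κ] [DecidableEq κ]
    {A : M → Matrix κ κ ℝ} {x : M} (hA : ∀ i j, MDiffAt (fun y => A y i j) x) :
    MDiffAt (fun y => (A y).det) x := by
  have h1 : MDifferentiableAt I 𝓘(ℝ, κ → κ → ℝ) (fun y i j => A y i j) x :=
    mdifferentiableAt_pi fun i => mdifferentiableAt_pi fun j => hA i j
  exact (Matrix.differentiable_det (κ := κ)).differentiableAt.mdifferentiableAt.comp x h1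

theorem mdifferentiableAt_mvfderiv_apply [IsManifold I ∞ M] {g : M → ℝ} {x : M}
    {X : Π x : M, TangentSpace I x} (hg : ContMDiffAt I 𝓘(ℝ) 2 g x) (hX : MDiffAt (T% X) x) :
    MDiffAt (fun y => mvfderiv I g y (X y)) x := by
  have h1 := (hg.mfderiv_const (m := 1) (by norm_num)).mdifferentiableAt one_ne_zero
  have h2 : MDifferentiableAt I 𝓘(ℝ).tangent
      (fun y => (TotalSpace.mk (g y) (mfderiv I 𝓘(ℝ) g y (X y)) : TangentBundle 𝓘(ℝ) ℝ)) x :=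
    MDifferentiableAt.clm_apply_of_inCoordinates (b₁ := id) (b₂ := g) h1 hX
      (hg.mdifferentiableAt (by norm_num))
  exact ((contMDiff_snd_tangentBundle_modelSpace ℝ 𝓘(ℝ)).contMDiffAt.mdifferentiableAt
    one_ne_zero).comp x h2

end Differentiability

/-! ### Local frames and the Gram matrix -/

section Frames

variable {E : Type*} [NormedAddCommGroup E] [NormedSpace ℝ E] [FiniteDimensional ℝ E]
  {H : Type*} [TopologicalSpace H] {I : ModelWithCorners ℝ E H}
  {M : Type*} [TopologicalSpace M] [ChartedSpace H M] [IsManifold I ∞ M]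
  [RiemannianBundle (fun x : M => TangentSpace I x)]
  [IsContMDiffRiemannianBundle I ∞ E (fun x : M => TangentSpace I x)]
  {κ : Type*} [Fintype κ] {s : κ → Π x : M, TangentSpace I x} {x : M}

theorem eventually_linearIndependent (hs : ∀ i, MDiffAt (T% (s i)) x)
    (hli : LinearIndependent ℝ (fun i => s i x)) :
    ∀ᶠ y in 𝓝 x, LinearIndependent ℝ (fun i => s i y) := by
  classical
  have hdet : MDiffAt (fun y => (Matrix.gram ℝ (fun i => s i y)).det) x :=
    Matrix.mdifferentiableAt_det fun i j => mdiffAt_inner (hs i) (hs j)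
  filter_upwards [hdet.continuousAt.eventually_ne
    (Matrix.det_gram_ne_zero_iff_linearIndependent.2 hli)] with y hy
  exact Matrix.linearIndependent_of_det_gram_ne_zero hy

/-- A field in the span of a frame has differentiable coefficients, if its inner products with
the frame are differentiable. -/
theorem exists_mdifferentiableAt_coeff {Y : Π x : M, TangentSpace I x}
    (hs : ∀ i, MDiffAt (T% (s i)) x) (hli : LinearIndependent ℝ (fun i => s i x))
    (hY : ∀ j, MDiffAt (fun y => (inner ℝ (s j y) (Y y) : ℝ)) x) :
    ∃ c : κ → M → ℝ, (∀ i, MDiffAt (c i) x) ∧ ∀ᶠ y in 𝓝 x,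
      Y y ∈ Submodule.span ℝ (range fun i => s i y) → Y y = ∑ i, c i y • s i y := by
  classical
  have hG : ∀ i j, MDiffAt (fun y => Matrix.gram ℝ (fun i => s i y) i j) x :=
    fun i j => mdiffAt_inner (hs i) (hs j)
  have hdet := Matrix.mdifferentiableAt_det hG
  have h0 := Matrix.det_gram_ne_zero_iff_linearIndependent.2 hli
  -- The coefficients solve the Gram system. Cramer's rule makes them quotients of differentiable
  -- functions whose denominator, the Gram determinant, does not vanish near `x`.
  have hc : ∀ i, MDiffAt (fun y => (Matrix.gram ℝ (fun i => s i y)).cramer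
      (fun j => inner ℝ (s j y) (Y y)) i) x := by
    intro i
    simp only [Matrix.cramer_apply]
    refine Matrix.mdifferentiableAt_det fun j k => ?_
    by_cases hk : k = i
    · subst hk
      simpa using hY j
    · simpa [Matrix.updateCol_ne hk] using hG j k
  refine ⟨fun i y => (Matrix.gram ℝ (fun i => s i y)).det⁻¹ *
    (Matrix.gram ℝ (fun i => s i y)).cramer (fun j => inner ℝ (s j y) (Y y)) i, fun i => ?_, ?_⟩
  · exact ((differentiableAt_inv h0).mdifferentiableAt.comp x hdet).mul (hc i)
  · filter_upwards [hdet.continuousAt.eventually_ne h0] with y hy hspan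
    obtain ⟨a, ha⟩ := (Submodule.mem_span_range_iff_exists_fun ℝ).1 hspan
    have h1 : (fun j => (inner ℝ (s j y) (Y y) : ℝ))
        = (Matrix.gram ℝ (fun i => s i y)).mulVec a := by
      ext j
      simp [← ha, inner_sum, inner_smul_right, Matrix.mulVec, dotProduct, mul_comm]
    rw [← ha] at h1 ⊢
    refine Finset.sum_congr rfl fun i _ => ?_
    rw [h1, Matrix.cramer_eq_adjugate_mulVec, Matrix.mulVec_mulVec, Matrix.adjugate_mul]
    simp only [Matrix.smul_mulVec, Matrix.one_mulVec, Pi.smul_apply, smul_eq_mul]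
    rw [inv_mul_cancel_left₀ hy]

/-- A field is differentiable if its inner products with differentiable fields that form a basis
at the point are. -/
theorem mdifferentiableAt_of_inner {Y : Π x : M, TangentSpace I x}
    (hY : ∀ v : TangentSpace I x,
      MDiffAt (fun y => (inner ℝ (FiberBundle.extend E v y) (Y y) : ℝ)) x) :
    MDiffAt (T% Y) x := by
  let b := Module.finBasis ℝ (TangentSpace I x)
  have hs : ∀ i, MDiffAt (T% (FiberBundle.extend E (b i) : Π x : M, TangentSpace I x)) x :=
    fun i => FiberBundle.mdifferentiableAt_extend ..
  have hli : LinearIndependent ℝ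
      (fun i => (FiberBundle.extend E (b i) : Π x : M, TangentSpace I x) x) := by
    simpa using b.linearIndependent
  obtain ⟨c, hc, hcY⟩ := exists_mdifferentiableAt_coeff hs hli fun i => hY (b i)
  have hsum : MDiffAt (T% (fun y => ∑ i, c i y •
      (FiberBundle.extend E (b i) : Π x : M, TangentSpace I x) y)) x :=
    .sum_section fun i _ => (hc i).smul_section (hs i)
  refine hsum.congr_of_eventuallyEq ?_
  filter_upwards [hcY, eventually_linearIndependent hs hli] with y hy hl
  have htop := hl.span_eq_top_of_card_eq_finrank' (by
    rw [Fintype.card_fin]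
    rfl)
  have := hy (htop ▸ Submodule.mem_top)
  rw [← this]

end Frames

/-! ### Regularity of covariant derivatives and tensoriality of curvature -/

section LeviCivitaRegularity

variable {E : Type*} [NormedAddCommGroup E] [NormedSpace ℝ E] [FiniteDimensional ℝ E]
  {H : Type*} [TopologicalSpace H] {I : ModelWithCorners ℝ E H}
  {M : Type*} [TopologicalSpace M] [ChartedSpace H M] [IsManifold I ∞ M]
  [RiemannianBundle (fun x : M => TangentSpace I x)]
  [IsContMDiffRiemannianBundle I ∞ E (fun x : M => TangentSpace I x)]

theorem mdifferentiableAt_koszul {X Y Z : Π x : M, TangentSpace I x} {x : M}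
    (hX : ContMDiffAt I I.tangent 2 (T% X) x) (hY : ContMDiffAt I I.tangent 2 (T% Y) x)
    (hZ : ContMDiffAt I I.tangent 2 (T% Z) x) :
    MDiffAt (koszul I Y X Z) x := by
  have : IsContMDiffRiemannianBundle I 2 E (fun x : M => TangentSpace I x) :=
    IsContMDiffRiemannianBundle.of_le (n := ∞) ENat.LEInfty.out
  have hi : ∀ {X Y : Π x : M, TangentSpace I x}, ContMDiffAt I I.tangent 2 (T% X) x →
      ContMDiffAt I I.tangent 2 (T% Y) x →
      ContMDiffAt I 𝓘(ℝ) 2 (fun y => (inner ℝ (X y) (Y y) : ℝ)) x := fun hX hY =>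
    ContMDiffAt.inner_bundle (E := fun x : M => TangentSpace I x) hX hY
  have hd : ∀ {X : Π x : M, TangentSpace I x}, ContMDiffAt I I.tangent 2 (T% X) x →
      MDiffAt (T% X) x := fun hX => hX.mdifferentiableAt (by norm_num)
  have hb : ∀ {X Y : Π x : M, TangentSpace I x}, ContMDiffAt I I.tangent 2 (T% X) x →
      ContMDiffAt I I.tangent 2 (T% Y) x →
      MDiffAt (T% (VectorField.mlieBracket I X Y)) x := fun hX hY => by
    have : IsManifold I ((2 : ℕ∞) + 1) M := IsManifold.of_le (n := ∞) (by exact_mod_cast le_top)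
    have : IsManifold I (minSmoothness ℝ 2) M :=
      IsManifold.of_le (n := ∞) (by simpa using ENat.LEInfty.out)
    have : IsManifold I (minSmoothness ℝ 3) M :=
      IsManifold.of_le (n := ∞) (by simpa using ENat.LEInfty.out)
    exact (ContMDiffAt.mlieBracket_vectorField (n := 2) (m := 1) hX hY
      (by simp; norm_num)).mdifferentiableAt one_ne_zero
  have h1 := mdifferentiableAt_mvfderiv_apply (hi hY hZ) (hd hX)
  have h2 := mdifferentiableAt_mvfderiv_apply (hi hZ hX) (hd hY)
  have h3 := mdifferentiableAt_mvfderiv_apply (hi hX hY) (hd hZ)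
  have h4 := mdiffAt_inner (hb hX hY) (hd hZ)
  have h5 := mdiffAt_inner (hb hX hZ) (hd hY)
  have h6 := mdiffAt_inner (hb hY hZ) (hd hX)
  exact (mdifferentiableAt_const (c := (1 / 2 : ℝ))).mul
    (((((h1.add h2).sub h3).add h4).sub h5).sub h6)

theorem mdifferentiableAt_leviCivita_of_contMDiffAt {X Y : Π x : M, TangentSpace I x} {x : M}
    (hX : ContMDiffAt I I.tangent 2 (T% X) x) (hY : ContMDiffAt I I.tangent 2 (T% Y) x) :
    MDiffAt (T% (fun y => leviCivita I M Y y (X y))) x := by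
  refine mdifferentiableAt_of_inner fun v => ?_
  have hZ : ContMDiffAt I I.tangent 2
      (T% (FiberBundle.extend E v : Π x : M, TangentSpace I x)) x :=
    FiberBundle.contMDiffAt_extend I E v
  refine (mdifferentiableAt_koszul hX hY hZ).congr_of_eventuallyEq ?_
  filter_upwards [(contMDiffAt_iff_contMDiffAt_nhds (by simp)).1 hX,
    (contMDiffAt_iff_contMDiffAt_nhds (by simp)).1 hY,
    (contMDiffAt_iff_contMDiffAt_nhds (by simp)).1 hZ]
    with y h1 h2 h3
  rw [real_inner_comm]
  exact inner_leviCivita (h2.mdifferentiableAt (by norm_num))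
    (h1.mdifferentiableAt (by norm_num)) (h3.mdifferentiableAt (by norm_num))

/-- Expanding `X` in a `C²` frame with differentiable coefficients reduces this to directions of
class `C²`. The weak hypothesis on `X` is needed because tensoriality is tested on fields that are
merely differentiable. -/
theorem mdifferentiableAt_leviCivita {X Y : Π x : M, TangentSpace I x} {x : M}
    (hX : MDiffAt (T% X) x) (hY : ContMDiffAt I I.tangent 2 (T% Y) x) :
    MDiffAt (T% (fun y => leviCivita I M Y y (X y))) x := by
  let b := Module.finBasis ℝ (TangentSpace I x)
  have hs : ∀ i, ContMDiffAt I I.tangent 2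
      (T% (FiberBundle.extend E (b i) : Π x : M, TangentSpace I x)) x :=
    fun i => FiberBundle.contMDiffAt_extend ..
  have hs' := fun i => (hs i).mdifferentiableAt (by norm_num)
  have hli : LinearIndependent ℝ
      (fun i => (FiberBundle.extend E (b i) : Π x : M, TangentSpace I x) x) := by
    simpa using b.linearIndependent
  obtain ⟨c, hc, hcX⟩ := exists_mdifferentiableAt_coeff hs' hli
    fun i => mdiffAt_inner (hs' i) hX
  have hsum : MDiffAt (T% (fun y => ∑ i, c i y • leviCivita I M Y y
      ((FiberBundle.extend E (b i) : Π x : M, TangentSpace I x) y))) x :=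
    .sum_section fun i _ => (hc i).smul_section
      (mdifferentiableAt_leviCivita_of_contMDiffAt (hs i) hY)
  refine hsum.congr_of_eventuallyEq ?_
  filter_upwards [hcX, eventually_linearIndependent hs' hli] with y hy hl
  have htop := hl.span_eq_top_of_card_eq_finrank' (by
    rw [Fintype.card_fin]
    rfl)
  have := hy (htop ▸ Submodule.mem_top)
  rw [this]
  simp

theorem leviCivita_add {Y Y' : Π x : M, TangentSpace I x} {x : M} (hY : MDiffAt (T% Y) x)
    (hY' : MDiffAt (T% Y') x) :
    leviCivita I M (Y + Y') x = leviCivita I M Y x + leviCivita I M Y' x :=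
  (leviCivita I M).isCovariantDerivativeOnUniv.add hY hY'

theorem leviCivita_smul {Y : Π x : M, TangentSpace I x} {f : M → ℝ} {x : M}
    (hf : MDiffAt f x) (hY : MDiffAt (T% Y) x) (v : TangentSpace I x) :
    leviCivita I M (f • Y) x v = f x • leviCivita I M Y x v + mvfderiv I f x v • Y x := by
  rw [(leviCivita I M).isCovariantDerivativeOnUniv.leibniz hY hf]
  simp

theorem leviCivita_congr {Y Y' : Π x : M, TangentSpace I x} {x : M} (hY : MDiffAt (T% Y) x)
    (h : Y =ᶠ[𝓝 x] Y') : leviCivita I M Y x = leviCivita I M Y' x :=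
  (leviCivita I M).isCovariantDerivativeOnUniv.congr_of_eventuallyEq hY
    (hY.congr_of_eventuallyEq (h.symm.mono fun y hy => by simp only [hy])) Filter.univ_mem h

theorem leviCivita_neg {Y : Π x : M, TangentSpace I x} {x : M} (hY : MDiffAt (T% Y) x) :
    leviCivita I M (-Y) x = -leviCivita I M Y x := by
  ext v
  have := leviCivita_smul (f := fun _ => (-1 : ℝ)) mdifferentiableAt_const hY v
  have e : (fun _ : M => (-1 : ℝ)) • Y = -Y := by ext; simp
  rw [e, mvfderiv_const] at this
  simpa using this

theorem mlieBracket_eq_leviCivita {X Y : Π x : M, TangentSpace I x} {x : M}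
    (hX : MDiffAt (T% X) x) (hY : MDiffAt (T% Y) x) :
    VectorField.mlieBracket I X Y x = leviCivita I M Y x (X x) - leviCivita I M X x (Y x) :=
  ((leviCivita I M).torsion_eq_zero_iff.1 leviCivita_torsion hX hY).symm

/-- When `X` is replaced by `f X`, the derivative of `f` enters through `∇_Y (f ∇_X Z)` and through
`[f X, Y]`, and the two contributions cancel. -/
theorem riemannCurvature_tensorial {Y Z : Π x : M, TangentSpace I x} {x : M}
    (hZ : ContMDiffAt I I.tangent 2 (T% Z) x) :
    TensorialAt I E (fun X => riemannCurvature I X Y Z x) x where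
  smul {f X} hf hX := by
    have h := leviCivita_smul hf (mdifferentiableAt_leviCivita hX hZ) (Y x)
    have e : (f • fun y => leviCivita I M Z y (X y)) = fun y => leviCivita I M Z y ((f • X) y) := by
      ext; simp
    rw [e] at h
    simp only [riemannCurvature]
    rw [h, VectorField.mlieBracket_smul_left hf hX]
    simp [mvfderiv]
    module
  add {X X'} hX hX' := by
    have h := leviCivita_add (mdifferentiableAt_leviCivita hX hZ)
      (mdifferentiableAt_leviCivita hX' hZ)
    have e : ((fun y => leviCivita I M Z y (X y)) + fun y => leviCivita I M Z y (X' y))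
        = fun y => leviCivita I M Z y ((X + X') y) := by
      ext; simp
    rw [e] at h
    simp only [riemannCurvature]
    rw [h, VectorField.mlieBracket_add_left hX hX']
    simp
    module

end LeviCivitaRegularity

/-! ### Vector fields and brackets in charts -/

section Charts

variable {n : ℕ} {M : Type*} [TopologicalSpace M]
  [ChartedSpace (EuclideanSpace ℝ (Fin (n + 1))) M] [IsManifold (𝓡 (n + 1)) ∞ M]
  {e : OpenPartialHomeomorph M (EuclideanSpace ℝ (Fin (n + 1)))}

theorem mdifferentiable_of_mem_maximalAtlas (he : e ∈ IsManifold.maximalAtlas (𝓡 (n + 1)) ∞ M) :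
    e.MDifferentiable (𝓡 (n + 1)) (𝓡 (n + 1)) :=
  ⟨(contMDiffOn_of_mem_maximalAtlas he).mdifferentiableOn (by simp),
    (contMDiffOn_symm_of_mem_maximalAtlas he).mdifferentiableOn (by simp)⟩

theorem contMDiffAt_lastCoord (he : e ∈ IsManifold.maximalAtlas (𝓡 (n + 1)) ∞ M) {x : M}
    (hx : x ∈ e.source) :
    ContMDiffAt (𝓡 (n + 1)) 𝓘(ℝ) ∞ (fun y => e y (Fin.last n)) x :=
  (EuclideanSpace.proj (𝕜 := ℝ) (Fin.last n)).contMDiff.contMDiffAt.comp x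
    (contMDiffAt_of_mem_maximalAtlas he hx)

theorem mvfderiv_lastCoord (he : e ∈ IsManifold.maximalAtlas (𝓡 (n + 1)) ∞ M) {x : M}
    (hx : x ∈ e.source) (v : TangentSpace (𝓡 (n + 1)) x) :
    mvfderiv (𝓡 (n + 1)) (fun y => e y (Fin.last n)) x v
      = mvfderiv (𝓡 (n + 1)) e x v (Fin.last n) := by
  have h := mvfderiv_differentiable_comp (I := 𝓡 (n + 1))
    (g := EuclideanSpace.proj (𝕜 := ℝ) (Fin.last n)) (f := e)
    (EuclideanSpace.proj (𝕜 := ℝ) (Fin.last n)).differentiableAt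
    ((contMDiffAt_of_mem_maximalAtlas he hx).mdifferentiableAt (by simp)) v
  rw [ContinuousLinearMap.fderiv] at h
  exact h

theorem mvfderiv_congr {g g' : M → ℝ} {x : M} (h : g =ᶠ[𝓝 x] g') :
    mvfderiv (𝓡 (n + 1)) g x = mvfderiv (𝓡 (n + 1)) g' x := by
  ext v
  exact congrArg (fun L : TangentSpace (𝓡 (n + 1)) x →L[ℝ] ℝ => L v) h.mfderiv_eq

theorem differentiableAt_comp_chart_symm (he : e ∈ IsManifold.maximalAtlas (𝓡 (n + 1)) ∞ M)
    {x : M} (hx : x ∈ e.source) {g : M → ℝ} (hg : MDifferentiableAt (𝓡 (n + 1)) 𝓘(ℝ) g x) :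
    DifferentiableAt ℝ (fun p => g (e.symm p)) (e x) := by
  have h : MDifferentiableAt (𝓡 (n + 1)) 𝓘(ℝ) (g ∘ e.symm) (e x) :=
    MDifferentiableAt.comp (e x) (by rwa [e.left_inv hx])
      ((mdifferentiable_of_mem_maximalAtlas he).mdifferentiableAt_symm (e.map_source hx))
  exact h.differentiableAt

theorem fderiv_comp_chart_symm (he : e ∈ IsManifold.maximalAtlas (𝓡 (n + 1)) ∞ M) {x : M}
    (hx : x ∈ e.source) {g : M → ℝ} (hg : MDifferentiableAt (𝓡 (n + 1)) 𝓘(ℝ) g x)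
    (v : TangentSpace (𝓡 (n + 1)) x) :
    fderiv ℝ (fun p => g (e.symm p)) (e x) (mvfderiv (𝓡 (n + 1)) e x v)
      = mvfderiv (𝓡 (n + 1)) g x v := by
  rw [← mvfderiv_differentiable_comp (differentiableAt_comp_chart_symm he hx hg)
    ((contMDiffAt_of_mem_maximalAtlas he hx).mdifferentiableAt (by simp)),
    mvfderiv_congr (g := g)]
  filter_upwards [e.open_source.mem_nhds hx] with y hy
  rw [e.left_inv hy]

/-- The derivative of a function along a straight line in a chart. -/
theorem hasDerivAt_chart_line (he : e ∈ IsManifold.maximalAtlas (𝓡 (n + 1)) ∞ M) {x : M}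
    (hx : x ∈ e.source) {g : M → ℝ} (hg : MDifferentiableAt (𝓡 (n + 1)) 𝓘(ℝ) g x)
    (v : TangentSpace (𝓡 (n + 1)) x) :
    HasDerivAt (fun s : ℝ => g (e.symm (e x + s • mvfderiv (𝓡 (n + 1)) e x v)))
      (mvfderiv (𝓡 (n + 1)) g x v) 0 := by
  rw [← fderiv_comp_chart_symm he hx hg v]
  have h3 : HasDerivAt (fun s : ℝ => e x + s • mvfderiv (𝓡 (n + 1)) e x v)
      (mvfderiv (𝓡 (n + 1)) e x v) 0 := by
    simpa using ((hasDerivAt_id (0 : ℝ)).smul_const (mvfderiv (𝓡 (n + 1)) e x v)).const_add (e x)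
  exact HasFDerivAt.comp_hasDerivAt (0 : ℝ)
    (by simpa using (differentiableAt_comp_chart_symm he hx hg).hasFDerivAt) h3

theorem mvfderiv_chart_surjective (he : e ∈ IsManifold.maximalAtlas (𝓡 (n + 1)) ∞ M) {x : M}
    (hx : x ∈ e.source) : Function.Surjective (mvfderiv (𝓡 (n + 1)) e x) :=
  (mdifferentiable_of_mem_maximalAtlas he).mfderiv_surjective hx

/-- The representation of a vector field in a chart. -/
noncomputable def chartField (e : OpenPartialHomeomorph M (EuclideanSpace ℝ (Fin (n + 1))))
    (X : Π x : M, TangentSpace (𝓡 (n + 1)) x) (p : EuclideanSpace ℝ (Fin (n + 1))) :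
    EuclideanSpace ℝ (Fin (n + 1)) :=
  VectorField.mpullback (𝓡 (n + 1)) (𝓡 (n + 1)) e.symm X p

theorem mfderiv_chart_comp_symm (he : e ∈ IsManifold.maximalAtlas (𝓡 (n + 1)) ∞ M)
    {p : EuclideanSpace ℝ (Fin (n + 1))} (hp : p ∈ e.target) :
    (mfderiv (𝓡 (n + 1)) (𝓡 (n + 1)) e.symm p).IsInvertible ∧
    (mfderiv (𝓡 (n + 1)) (𝓡 (n + 1)) e.symm p).inverse
      = mfderiv (𝓡 (n + 1)) (𝓡 (n + 1)) e (e.symm p) := by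
  have h1 := (mdifferentiable_of_mem_maximalAtlas he).comp_symm_deriv hp
  have h2 := (mdifferentiable_of_mem_maximalAtlas he).symm_comp_deriv (e.map_target hp)
  rw [e.right_inv hp] at h2
  exact ⟨.of_inverse h2 h1, ContinuousLinearMap.inverse_eq h2 h1⟩

theorem chartField_apply (he : e ∈ IsManifold.maximalAtlas (𝓡 (n + 1)) ∞ M)
    (X : Π x : M, TangentSpace (𝓡 (n + 1)) x) {p : EuclideanSpace ℝ (Fin (n + 1))}
    (hp : p ∈ e.target) :
    chartField e X p = mvfderiv (𝓡 (n + 1)) e (e.symm p) (X (e.symm p)) :=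
  congrArg (fun L : TangentSpace (𝓡 (n + 1)) (e.symm p) →L[ℝ] EuclideanSpace ℝ (Fin (n + 1)) =>
    L (X (e.symm p))) (mfderiv_chart_comp_symm he hp).2

theorem chartField_apply_last (he : e ∈ IsManifold.maximalAtlas (𝓡 (n + 1)) ∞ M)
    (X : Π x : M, TangentSpace (𝓡 (n + 1)) x) {p : EuclideanSpace ℝ (Fin (n + 1))}
    (hp : p ∈ e.target) :
    chartField e X p (Fin.last n)
      = mvfderiv (𝓡 (n + 1)) (fun y => e y (Fin.last n)) (e.symm p) (X (e.symm p)) := by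
  rw [chartField_apply he X hp, mvfderiv_lastCoord he (e.map_target hp)]

theorem contDiffAt_chartField (he : e ∈ IsManifold.maximalAtlas (𝓡 (n + 1)) ∞ M)
    {X : Π x : M, TangentSpace (𝓡 (n + 1)) x} {x : M} (hx : x ∈ e.source)
    (hX : ContMDiffAt (𝓡 (n + 1)) (𝓡 (n + 1)).tangent 1 (T% X) x) :
    ContDiffAt ℝ 1 (chartField e X) (e x) := by
  have hp := e.map_source hx
  have h := ContMDiffAt.mpullback_vectorField_preimage (I := 𝓡 (n + 1)) (I' := 𝓡 (n + 1))
    (m := 1) (n := ∞) (f := e.symm) (x₀ := e x) (V := X) (by rwa [e.left_inv hx])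
    (contMDiffAt_symm_of_mem_maximalAtlas he hp) (mfderiv_chart_comp_symm he hp).1
    (by norm_num; exact ENat.LEInfty.out)
  exact contMDiffAt_vectorSpace_iff_contDiffAt.1 h

theorem differentiableAt_chartField (he : e ∈ IsManifold.maximalAtlas (𝓡 (n + 1)) ∞ M)
    {X : Π x : M, TangentSpace (𝓡 (n + 1)) x} {x : M} (hx : x ∈ e.source)
    (hX : MDifferentiableAt (𝓡 (n + 1)) (𝓡 (n + 1)).tangent (T% X) x) :
    DifferentiableAt ℝ (chartField e X) (e x) := by
  have hp := e.map_source hx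
  have h := MDifferentiableAt.mpullback_vectorField (I := 𝓡 (n + 1)) (I' := 𝓡 (n + 1))
    (n := ∞) (f := e.symm) (x₀ := e x) (V := X) (by rwa [e.left_inv hx])
      (contMDiffAt_symm_of_mem_maximalAtlas he hp)
      (mfderiv_chart_comp_symm he hp).1 ENat.LEInfty.out
  have h2 := ((contMDiff_snd_tangentBundle_modelSpace (EuclideanSpace ℝ (Fin (n + 1)))
    (𝓡 (n + 1))).contMDiffAt.mdifferentiableAt one_ne_zero).comp (e x) h
  exact h2.differentiableAt

/-- In the chart the bracket is `DY(X) - DX(Y)`, and the last component of a field is its derivative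
of the last coordinate. -/
theorem mvfderiv_lastCoord_mlieBracket (he : e ∈ IsManifold.maximalAtlas (𝓡 (n + 1)) ∞ M)
    {X Y : Π x : M, TangentSpace (𝓡 (n + 1)) x} {x : M} (hx : x ∈ e.source)
    (hX : MDifferentiableAt (𝓡 (n + 1)) (𝓡 (n + 1)).tangent (T% X) x)
    (hY : MDifferentiableAt (𝓡 (n + 1)) (𝓡 (n + 1)).tangent (T% Y) x) :
    mvfderiv (𝓡 (n + 1)) (fun y => e y (Fin.last n)) x
        (VectorField.mlieBracket (𝓡 (n + 1)) X Y x)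
      = mvfderiv (𝓡 (n + 1))
          (fun y => mvfderiv (𝓡 (n + 1)) (fun y => e y (Fin.last n)) y (Y y)) x (X x)
        - mvfderiv (𝓡 (n + 1))
          (fun y => mvfderiv (𝓡 (n + 1)) (fun y => e y (Fin.last n)) y (X y)) x (Y x) := by
  have hp := e.map_source hx
  have key : ∀ {X Y : Π x : M, TangentSpace (𝓡 (n + 1)) x},
      MDifferentiableAt (𝓡 (n + 1)) (𝓡 (n + 1)).tangent (T% Y) x → mvfderiv (𝓡 (n + 1))
          (fun y => mvfderiv (𝓡 (n + 1)) (fun y => e y (Fin.last n)) y (Y y)) x (X x)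
        = fderiv ℝ (chartField e Y) (e x) (chartField e X (e x)) (Fin.last n) := by
    intro X Y hY
    rw [← fderiv_comp_chart_symm he hx (mdifferentiableAt_mvfderiv_apply
      ((contMDiffAt_lastCoord he hx).of_le ENat.LEInfty.out) hY)]
    have h1 : (fun p => mvfderiv (𝓡 (n + 1)) (fun y => e y (Fin.last n)) (e.symm p)
        (Y (e.symm p))) =ᶠ[𝓝 (e x)] EuclideanSpace.proj (𝕜 := ℝ) (Fin.last n) ∘ chartField e Y := by
      filter_upwards [e.open_target.mem_nhds hp] with p hp
      exact (chartField_apply_last he Y hp).symm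
    have h2 : chartField e X (e x) = mvfderiv (𝓡 (n + 1)) e x (X x) := by
      have := chartField_apply he X hp
      rwa [e.left_inv hx] at this
    rw [h1.fderiv_eq, ((EuclideanSpace.proj (𝕜 := ℝ) (Fin.last n)).hasFDerivAt.comp _
      (differentiableAt_chartField he hx hY).hasFDerivAt).fderiv, h2]
    rfl
  rw [key hX, key hY]
  have hbr : chartField e (VectorField.mlieBracket (𝓡 (n + 1)) X Y) (e x)
      = VectorField.lieBracket ℝ (chartField e X) (chartField e Y) (e x) := by
    have : IsManifold (𝓡 (n + 1)) (minSmoothness ℝ 2) M :=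
      IsManifold.of_le (n := ∞) (by simpa using ENat.LEInfty.out)
    have : IsManifold (𝓡 (n + 1)) (minSmoothness ℝ 3) M :=
      IsManifold.of_le (n := ∞) (by simpa using ENat.LEInfty.out)
    have h := VectorField.mpullback_mlieBracket (I := 𝓡 (n + 1)) (I' := 𝓡 (n + 1)) (n := ∞)
      (f := e.symm) (x₀ := e x) (V := X) (W := Y) (by rwa [e.left_inv hx])
      (by rwa [e.left_inv hx]) (contMDiffAt_symm_of_mem_maximalAtlas he hp)
      (by simpa using ENat.LEInfty.out)
    rw [← VectorField.mlieBracketWithin_univ (I := 𝓡 (n + 1))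
      (M := EuclideanSpace ℝ (Fin (n + 1))), VectorField.mlieBracketWithin_eq_lieBracketWithin]
      at h
    exact h.trans (congrFun (VectorField.lieBracketWithin_univ (𝕜 := ℝ) (V := chartField e X)
      (W := chartField e Y)) (e x))
  have h2 := chartField_apply_last he (VectorField.mlieBracket (𝓡 (n + 1)) X Y) hp
  rw [e.left_inv hx] at h2
  rw [← h2, hbr]
  rfl

end Charts

/-! ### Tangent spaces of the leaves -/

namespace CodimOneFoliation

section Leaves

variable {n : ℕ} {M : Type*} [TopologicalSpace M]
  [ChartedSpace (EuclideanSpace ℝ (Fin (n + 1))) M] [IsManifold (𝓡 (n + 1)) ∞ M]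
  (F : CodimOneFoliation n M)

/-- The transition function `h` is not assumed differentiable, so the chain rule is avoided. Along
the straight line in `e` with direction `v` the old last coordinate is constant, hence so is its
image under `h`, which is the new one. -/
theorem ker_mvfderiv_le {e e' : OpenPartialHomeomorph M (EuclideanSpace ℝ (Fin (n + 1)))}
    (he : e ∈ F.atlas) (he' : e' ∈ F.atlas) {x : M} (hx : x ∈ e.source) (hx' : x ∈ e'.source)
    {v : TangentSpace (𝓡 (n + 1)) x}
    (hv : mvfderiv (𝓡 (n + 1)) (fun y => e y (Fin.last n)) x v = 0) :
    mvfderiv (𝓡 (n + 1)) (fun y => e' y (Fin.last n)) x v = 0 := by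
  have h1 := hasDerivAt_chart_line (F.smooth e he) hx
    ((contMDiffAt_lastCoord (F.smooth e' he') hx').mdifferentiableAt (by simp)) v
  refine h1.unique ?_
  rw [mvfderiv_lastCoord (F.smooth e he) hx] at hv
  set ξ := mvfderiv (𝓡 (n + 1)) e x v with hξ
  obtain ⟨h, hh⟩ := F.compatible e he e' he' x ⟨hx, hx'⟩
  have hc : ContinuousAt (fun s : ℝ => e.symm (e x + s • ξ)) 0 := by
    refine ContinuousAt.comp (f := fun s : ℝ => e x + s • ξ) (g := e.symm) ?_
      (by fun_prop)
    simpa using e.continuousAt_symm (e.map_source hx)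
  have hc' : ContinuousAt (fun s : ℝ => e x + s • ξ) 0 := by fun_prop
  have h0 : e.symm (e x + (0 : ℝ) • ξ) = x := by simpa using e.left_inv hx
  have ev1 : ∀ᶠ s : ℝ in 𝓝 0, e x + s • ξ ∈ e.target :=
    hc'.eventually_mem (by simpa using e.open_target.mem_nhds (e.map_source hx))
  have ev2 : ∀ᶠ s : ℝ in 𝓝 0, e' (e.symm (e x + s • ξ)) (Fin.last n)
      = h (e (e.symm (e x + s • ξ)) (Fin.last n)) := by
    rw [← h0] at hh
    exact hc.eventually hh
  refine (hasDerivAt_const (0 : ℝ) (h (e x (Fin.last n)))).congr_of_eventuallyEq ?_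
  filter_upwards [ev1, ev2] with s hs1 hs2
  rw [hs2, e.right_inv hs1]
  simp [hv]

theorem mem_tangent_iff {e : OpenPartialHomeomorph M (EuclideanSpace ℝ (Fin (n + 1)))}
    (he : e ∈ F.atlas) {x : M} (hx : x ∈ e.source) {v : TangentSpace (𝓡 (n + 1)) x} :
    v ∈ F.tangent x ↔ mvfderiv (𝓡 (n + 1)) (fun y => e y (Fin.last n)) x v = 0 := by
  simp only [tangent, Submodule.mem_iInf, mem_ofPred_eq, and_imp]
  exact ⟨fun h => h e he hx, fun h e' he' hx' => F.ker_mvfderiv_le he he' hx hx' h⟩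

theorem mvfderiv_lastCoord_ne_zero {e : OpenPartialHomeomorph M (EuclideanSpace ℝ (Fin (n + 1)))}
    (he : e ∈ IsManifold.maximalAtlas (𝓡 (n + 1)) ∞ M) {x : M} (hx : x ∈ e.source) :
    mvfderiv (𝓡 (n + 1)) (fun y => e y (Fin.last n)) x ≠ 0 := by
  obtain ⟨v, hv⟩ := mvfderiv_chart_surjective he hx
    (EuclideanSpace.single (Fin.last n) (1 : ℝ))
  intro h
  have := mvfderiv_lastCoord he hx v
  rw [h, hv] at this
  simp at this

theorem finrank_tangent (x : M) : Module.finrank ℝ (F.tangent x) = n := by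
  obtain ⟨e, he, hx⟩ := F.cover x
  have h : F.tangent x = LinearMap.ker
      (mvfderiv (𝓡 (n + 1)) (fun y => e y (Fin.last n)) x).toLinearMap := by
    ext v
    exact F.mem_tangent_iff he hx
  have h1 := Module.Dual.finrank_ker_add_one_of_ne_zero
    (f := (mvfderiv (𝓡 (n + 1)) (fun y => e y (Fin.last n)) x).toLinearMap)
    (fun h0 => mvfderiv_lastCoord_ne_zero (F.smooth e he) hx (by ext v; exact congrArg (· v) h0))
  rw [← h] at h1
  have h2 : Module.finrank ℝ (TangentSpace (𝓡 (n + 1)) x) = n + 1 :=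
    finrank_euclideanSpace_fin (𝕜 := ℝ) (n := n + 1)
  rw [h2] at h1
  omega

end Leaves

end CodimOneFoliation

/-! ### Unit normal, shape operator and Newton transformations of the leaves -/

namespace CodimOneFoliation

section Normal

variable {n : ℕ} {M : Type*} [TopologicalSpace M]
  [ChartedSpace (EuclideanSpace ℝ (Fin (n + 1))) M] [IsManifold (𝓡 (n + 1)) ∞ M]
  [RiemannianBundle (fun x : M => TangentSpace (𝓡 (n + 1)) x)]
  [IsContMDiffRiemannianBundle (𝓡 (n + 1)) ∞ (EuclideanSpace ℝ (Fin (n + 1)))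
    (fun x : M => TangentSpace (𝓡 (n + 1)) x)]
  {F : CodimOneFoliation n M} {N : Π x : M, TangentSpace (𝓡 (n + 1)) x}

theorem IsUnitNormal.inner_self (hN : F.IsUnitNormal N) (x : M) : (inner ℝ (N x) (N x) : ℝ) = 1 := by
  rw [real_inner_self_eq_norm_sq, hN.norm_eq_one, one_pow]

/-- One inclusion is normality of `N`; equality follows because both spaces have dimension `n`. -/
theorem IsUnitNormal.mem_tangent_iff_inner (hN : F.IsUnitNormal N) {x : M}
    {v : TangentSpace (𝓡 (n + 1)) x} : v ∈ F.tangent x ↔ (inner ℝ v (N x) : ℝ) = 0 := by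
  have hfr : Module.finrank ℝ (TangentSpace (𝓡 (n + 1)) x) = n + 1 :=
    finrank_euclideanSpace_fin (𝕜 := ℝ) (n := n + 1)
  have hfact : Fact (Module.finrank ℝ (TangentSpace (𝓡 (n + 1)) x) = n + 1) := ⟨hfr⟩
  have h0 : N x ≠ 0 := fun h => by simpa [h] using hN.norm_eq_one x
  have h : F.tangent x = (Submodule.span ℝ {N x})ᗮ := by
    refine Submodule.eq_of_le_of_finrank_eq ?_ ?_
    · intro w hw
      rw [Submodule.mem_orthogonal_singleton_iff_inner_left]
      exact (Submodule.mem_orthogonal _ _).1 (hN.normal x) w hw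
    · rw [F.finrank_tangent, Submodule.finrank_orthogonal_span_singleton (n := n) h0]
  rw [h, Submodule.mem_orthogonal_singleton_iff_inner_left]

theorem IsUnitNormal.coe_tangentPart (hN : F.IsUnitNormal N) {x : M}
    (v : TangentSpace (𝓡 (n + 1)) x) :
    (F.tangentPart x v : TangentSpace (𝓡 (n + 1)) x) = v - (inner ℝ v (N x) : ℝ) • N x := by
  refine Submodule.eq_starProjection_of_mem_of_inner_eq_zero ?_ ?_
  · rw [hN.mem_tangent_iff_inner, inner_sub_left, inner_smul_left, hN.inner_self]
    simp
  · intro w hw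
    rw [sub_sub_cancel, inner_smul_left, real_inner_comm w,
      hN.mem_tangent_iff_inner.1 hw, mul_zero]

theorem tangentPart_coe {x : M} (v : F.tangent x) : F.tangentPart x (v : TangentSpace (𝓡 (n + 1)) x) = v :=
  Submodule.orthogonalProjectionOnto_mem_subspace_eq_self v

theorem inner_tangentPart {x : M} (v : TangentSpace (𝓡 (n + 1)) x) (w : F.tangent x) :
    (inner ℝ (F.tangentPart x v) w : ℝ) = inner ℝ v (w : TangentSpace (𝓡 (n + 1)) x) :=
  Submodule.inner_orthogonalProjectionOnto_eq_of_mem_right w v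

theorem IsUnitNormal.tangentPart_smul (hN : F.IsUnitNormal N) {x : M} (a : ℝ) :
    F.tangentPart x (a • N x) = 0 := by
  ext
  rw [hN.coe_tangentPart, inner_smul_left, hN.inner_self]
  simp

theorem IsUnitNormal.normalPart_eq (hN : F.IsUnitNormal N)
    (V : Π x : M, TangentSpace (𝓡 (n + 1)) x) :
    F.normalPart V = (fun x => (inner ℝ (V x) (N x) : ℝ)) • N := by
  ext1 x
  rw [normalPart, hN.coe_tangentPart, sub_sub_cancel]
  rfl

theorem IsUnitNormal.mdifferentiableAt (hN : F.IsUnitNormal N) (x : M) : MDifferentiableAt (𝓡 (n + 1)) (𝓡 (n + 1)).tangent (T% N) x :=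
  (hN.smooth x).mdifferentiableAt (by simp)

theorem IsUnitNormal.contMDiffAt_two (hN : F.IsUnitNormal N) (x : M) :
    ContMDiffAt (𝓡 (n + 1)) (𝓡 (n + 1)).tangent 2 (T% N) x :=
  (hN.smooth x).of_le ENat.LEInfty.out

theorem IsUnitNormal.inner_leviCivita (hN : F.IsUnitNormal N) {x : M}
    (v : TangentSpace (𝓡 (n + 1)) x) :
    (inner ℝ (leviCivita (𝓡 (n + 1)) M N x v) (N x) : ℝ) = 0 := by
  have h := leviCivita_metric (X := FiberBundle.extend (EuclideanSpace ℝ (Fin (n + 1))) v)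
    (FiberBundle.mdifferentiableAt_extend ..) (hN.mdifferentiableAt x) (hN.mdifferentiableAt x)
  simp only [hN.inner_self, FiberBundle.extend_apply_self, mvfderiv_const] at h
  rw [real_inner_comm _ (N x)] at h
  simp at h
  linarith

/-- Differentiating `⟨N, N⟩ = 1` shows that `∇_v N` is already tangent, so the projection changes
nothing. -/
theorem IsUnitNormal.coe_shape (hN : F.IsUnitNormal N) {x : M} (v : F.tangent x) :
    (F.shape N x v : TangentSpace (𝓡 (n + 1)) x)
      = -leviCivita (𝓡 (n + 1)) M N x (v : TangentSpace (𝓡 (n + 1)) x) := by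
  simp [shape, hN.coe_tangentPart, hN.inner_leviCivita]

/-- A differentiable extension of a vector to a field tangent to the leaves. -/
noncomputable def tangentExtend (N : Π x : M, TangentSpace (𝓡 (n + 1)) x) {x : M}
    (v : TangentSpace (𝓡 (n + 1)) x) : Π y : M, TangentSpace (𝓡 (n + 1)) y :=
  FiberBundle.extend (EuclideanSpace ℝ (Fin (n + 1))) v - (fun y => (inner ℝ
    (FiberBundle.extend (EuclideanSpace ℝ (Fin (n + 1))) v y : TangentSpace (𝓡 (n + 1)) y)
      (N y) : ℝ)) • N

theorem IsUnitNormal.tangentExtend_mem (hN : F.IsUnitNormal N) {x : M}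
    (v : TangentSpace (𝓡 (n + 1)) x) (y : M) : tangentExtend N v y ∈ F.tangent y := by
  rw [hN.mem_tangent_iff_inner]
  simp [tangentExtend, inner_sub_left, inner_smul_left, hN.norm_eq_one]

theorem IsUnitNormal.tangentExtend_self (hN : F.IsUnitNormal N) {x : M} (v : F.tangent x) :
    tangentExtend N (v : TangentSpace (𝓡 (n + 1)) x) x = v := by
  simp [tangentExtend, hN.mem_tangent_iff_inner.1 v.2]

theorem IsUnitNormal.mdifferentiableAt_tangentExtend (hN : F.IsUnitNormal N) {x : M}
    (v : TangentSpace (𝓡 (n + 1)) x) : MDifferentiableAt (𝓡 (n + 1)) (𝓡 (n + 1)).tangent (T% (tangentExtend N v)) x := by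
  have h : MDifferentiableAt (𝓡 (n + 1)) (𝓡 (n + 1)).tangent (T% (FiberBundle.extend (EuclideanSpace ℝ (Fin (n + 1))) v :
      Π y : M, TangentSpace (𝓡 (n + 1)) y)) x := FiberBundle.mdifferentiableAt_extend ..
  exact mdifferentiableAt_sub_section h
    ((mdiffAt_inner h (hN.mdifferentiableAt x)).smul_section (hN.mdifferentiableAt x))

theorem mlieBracket_mem_tangent {X Y : Π x : M, TangentSpace (𝓡 (n + 1)) x} {x : M}
    (hX : MDifferentiableAt (𝓡 (n + 1)) (𝓡 (n + 1)).tangent (T% X) x) (hY : MDifferentiableAt (𝓡 (n + 1)) (𝓡 (n + 1)).tangent (T% Y) x) (hXt : ∀ᶠ y in 𝓝 x, X y ∈ F.tangent y)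
    (hYt : ∀ᶠ y in 𝓝 x, Y y ∈ F.tangent y) :
    VectorField.mlieBracket (𝓡 (n + 1)) X Y x ∈ F.tangent x := by
  obtain ⟨e, he, hx⟩ := F.cover x
  have h : ∀ {X : Π x : M, TangentSpace (𝓡 (n + 1)) x}, (∀ᶠ y in 𝓝 x, X y ∈ F.tangent y) →
      ∀ v, mvfderiv (𝓡 (n + 1))
        (fun y => mvfderiv (𝓡 (n + 1)) (fun y => e y (Fin.last n)) y (X y)) x v = 0 := by
    intro X hX v
    rw [mvfderiv_congr (g' := fun _ => 0), mvfderiv_const]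
    · rfl
    · filter_upwards [hX, e.open_source.mem_nhds hx] with y hy hy'
      exact (F.mem_tangent_iff he hy').1 hy
  rw [F.mem_tangent_iff he hx, mvfderiv_lastCoord_mlieBracket (F.smooth e he) hx hX hY,
    h hXt, h hYt, sub_zero]

/-- For tangent extensions `X, Y` of the two vectors, metric compatibility turns the asymmetry of
`A` into `⟨∇_X Y - ∇_Y X, N⟩ = ⟨[X, Y], N⟩`, which is zero by involutivity. -/
theorem IsUnitNormal.isSymmetric_shape (hN : F.IsUnitNormal N) (x : M) :
    (F.shape N x).IsSymmetric := by
  intro v w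
  have hX := hN.mdifferentiableAt_tangentExtend (v : TangentSpace (𝓡 (n + 1)) x)
  have hY := hN.mdifferentiableAt_tangentExtend (w : TangentSpace (𝓡 (n + 1)) x)
  have hXt := hN.tangentExtend_mem (v : TangentSpace (𝓡 (n + 1)) x)
  have hYt := hN.tangentExtend_mem (w : TangentSpace (𝓡 (n + 1)) x)
  have hb := mlieBracket_mem_tangent hX hY (.of_forall hXt) (.of_forall hYt)
  have h0 : ∀ {Y : Π x : M, TangentSpace (𝓡 (n + 1)) x}, (∀ y, Y y ∈ F.tangent y) →
      (fun y => (inner ℝ (Y y) (N y) : ℝ)) = fun _ => 0 := fun h => by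
    ext y
    exact hN.mem_tangent_iff_inner.1 (h y)
  have h1 := leviCivita_metric hX hY (hN.mdifferentiableAt x)
  have h2 := leviCivita_metric hY hX (hN.mdifferentiableAt x)
  rw [h0 hYt, mvfderiv_const] at h1
  rw [h0 hXt, mvfderiv_const] at h2
  rw [mlieBracket_eq_leviCivita hX hY, hN.mem_tangent_iff_inner, inner_sub_left] at hb
  simp only [hN.tangentExtend_self] at h1 h2 hb
  simp only [Submodule.coe_inner, hN.coe_shape, inner_neg_left, inner_neg_right]
  rw [real_inner_comm (w : TangentSpace (𝓡 (n + 1)) x)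
    (leviCivita (𝓡 (n + 1)) M N x (v : TangentSpace (𝓡 (n + 1)) x))] at *
  simp at h1 h2
  linarith

/-- Symmetry of the shape operator makes its characteristic polynomial split. Any basis may be used,
so a frame need not be orthonormal. -/
theorem IsUnitNormal.meanCurvature_eq (hN : F.IsUnitNormal N) {ι : Type*} [Fintype ι]
    [DecidableEq ι] {x : M} (b : Module.Basis ι ℝ (F.tangent x)) (k : ℕ) :
    F.meanCurvature N k x = (LinearMap.toMatrix b b (F.shape N x)).eigenEsymm k := by
  rw [meanCurvature, ← LinearMap.charpoly_toMatrix _ b, Matrix.charpoly_roots_esymm]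
  rw [LinearMap.charpoly_toMatrix]
  exact (hN.isSymmetric_shape x).splits_charpoly

theorem IsUnitNormal.toMatrix_newton (hN : F.IsUnitNormal N) {ι : Type*} [Fintype ι]
    [DecidableEq ι] {x : M} (b : Module.Basis ι ℝ (F.tangent x)) (k : ℕ) :
    LinearMap.toMatrix b b (F.newton N x k)
      = (LinearMap.toMatrix b b (F.shape N x)).newtonTransform k := by
  induction k with
  | zero => simp [newton, Matrix.newtonTransform]
  | succ k ih =>
    rw [newton, map_sub, map_smul, LinearMap.toMatrix_id, LinearMap.toMatrix_comp b b b, ih,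
      hN.meanCurvature_eq b]
    rfl

theorem IsUnitNormal.commute_newton (hN : F.IsUnitNormal N) (x : M) (k : ℕ) :
    Commute (F.shape N x) (F.newton N x k) := by
  let b := Module.finBasis ℝ (F.tangent x)
  refine (LinearMap.toMatrixAlgEquiv b).injective ?_
  rw [map_mul, map_mul]
  have := hN.toMatrix_newton b k
  change LinearMap.toMatrix b b _ * LinearMap.toMatrix b b _ =
    LinearMap.toMatrix b b _ * LinearMap.toMatrix b b _
  rw [this]
  exact Matrix.commute_newtonTransform _ _

end Normal

end CodimOneFoliation

/-! ### Countability of the plaques of a leaf -/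

theorem Set.Countable.setOf_reflTransGen {α : Type*} {R : α → α → Prop}
    (hR : ∀ a, {b | R a b}.Countable) (a : α) : {b | Relation.ReflTransGen R a b}.Countable := by
  let S : ℕ → Set α := fun k => k.rec {a} fun _ s => ⋃ b ∈ s, {c | R b c}
  have hS : ∀ k, (S k).Countable := by
    intro k
    induction k with
    | zero => exact countable_singleton a
    | succ k ih => exact ih.biUnion fun b _ => hR b
  refine (countable_iUnion hS).mono fun b hb => ?_
  rw [mem_iUnion]
  induction hb with
  | refl => exact ⟨0, rfl⟩
  | tail _ hbc ih =>
    obtain ⟨k, hk⟩ := ih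
    exact ⟨k + 1, mem_biUnion hk hbc⟩

namespace CodimOneFoliation

section Plaques

variable {n : ℕ} {M : Type*} [TopologicalSpace M]
  [ChartedSpace (EuclideanSpace ℝ (Fin (n + 1))) M] (F : CodimOneFoliation n M)

/-- The plaques `p` and `q`, each given by a chart and a height, intersect. -/
def PlaqueAdj {A : Set (OpenPartialHomeomorph M (EuclideanSpace ℝ (Fin (n + 1))))}
    (p q : A × ℝ) : Prop :=
  ∃ y ∈ p.1.1.source ∩ q.1.1.source, p.1.1 y (Fin.last n) = p.2 ∧ q.1.1 y (Fin.last n) = q.2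

variable {F} {A : Set (OpenPartialHomeomorph M (EuclideanSpace ℝ (Fin (n + 1))))}

/-- On a plaque of one chart the last coordinate of another is locally constant, by compatibility. A
countable subcover of the overlap leaves only countably many values. -/
theorem countable_setOf_plaqueAdj [SecondCountableTopology M] (hA : A.Countable)
    (hAF : A ⊆ F.atlas) (p : A × ℝ) : {q : A × ℝ | PlaqueAdj p q}.Countable := by
  have := hA.to_subtype
  have key : ∀ j : A, {t : ℝ | PlaqueAdj p (j, t)}.Countable := by
    intro j
    let S : Set M := {y | y ∈ p.1.1.source ∩ j.1.source ∧ p.1.1 y (Fin.last n) = p.2}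
    have h : ∀ x ∈ S, {y | j.1 y (Fin.last n) = j.1 x (Fin.last n)} ∈ 𝓝[S] x := by
      intro x hx
      obtain ⟨h, hh⟩ := F.compatible p.1 (hAF p.1.2) j (hAF j.2) x hx.1
      have hhx := hh.self_of_nhds
      filter_upwards [mem_nhdsWithin_of_mem_nhds hh, self_mem_nhdsWithin] with y hy hyS
      exact hy.trans (by rw [hhx, hyS.2, hx.2])
    obtain ⟨T, hTS, hT, hST⟩ := TopologicalSpace.countable_cover_nhdsWithin h
    refine (hT.image fun y => j.1 y (Fin.last n)).mono ?_
    rintro t ⟨y, hy, hyp, hyt⟩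
    obtain ⟨z, hz, hzy⟩ := mem_iUnion₂.1 (hST (show y ∈ S from ⟨hy, hyp⟩))
    exact ⟨z, hz, (hzy : _ = _).symm.trans hyt⟩
  refine (countable_iUnion fun j : A => (key j).image (Prod.mk j)).mono ?_
  rintro ⟨j, t⟩ h
  exact mem_iUnion.2 ⟨j, t, h, rfl⟩

/-- A curve in a leaf passes through a chain of intersecting plaques. -/
theorem IsLeafCurve.reflTransGen_plaqueAdj (hAF : A ⊆ F.atlas) (hcov : ∀ x, ∃ e ∈ A, x ∈ e.source)
    {c : unitInterval → M} (hc : F.IsLeafCurve c) (i j : A) {a b : unitInterval}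
    (ha : c a ∈ i.1.source) (hb : c b ∈ j.1.source) :
    Relation.ReflTransGen PlaqueAdj (i, i.1 (c a) (Fin.last n)) (j, j.1 (c b) (Fin.last n)) := by
  -- Reachability of the plaque at `c s` does not depend on the chart, since two plaques through one
  -- point are adjacent. It is locally constant in `s`, hence constant on the interval.
  let G : unitInterval → Prop := fun s => ∀ j : A, c s ∈ j.1.source →
    Relation.ReflTransGen PlaqueAdj (i, i.1 (c a) (Fin.last n)) (j, j.1 (c s) (Fin.last n))
  have hG : ∀ s (k : A), c s ∈ k.1.source → (G s ↔ Relation.ReflTransGen PlaqueAdj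
      (i, i.1 (c a) (Fin.last n)) (k, k.1 (c s) (Fin.last n))) := fun s k hk =>
    ⟨fun h => h k hk, fun h j hj => h.tail ⟨c s, ⟨hk, hj⟩, rfl, rfl⟩⟩
  have hlc : IsLocallyConstant G := by
    rw [IsLocallyConstant.iff_eventually_eq]
    intro s
    obtain ⟨k, hkA, hk⟩ := hcov (c s)
    filter_upwards [hc.1.continuousAt.eventually_mem (k.open_source.mem_nhds hk),
      hc.2 s k (hAF hkA) hk] with s' hs' hs
    refine propext ?_
    rw [hG s ⟨k, hkA⟩ hk, hG s' ⟨k, hkA⟩ hs', hs]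
  have h0 : G a := (hG a i ha).2 .refl
  rw [hlc.apply_eq_of_preconnectedSpace a b] at h0
  exact h0 j hb

/-- A leaf meets a foliated chart in countably many plaques. -/
theorem countable_lastCoord_of_mem_leaf [SecondCountableTopology M] (w : M)
    {e : OpenPartialHomeomorph M (EuclideanSpace ℝ (Fin (n + 1)))} (he : e ∈ F.atlas) :
    {t : ℝ | ∃ L, F.IsLeaf L ∧ w ∈ L ∧ ∃ y ∈ L ∩ e.source, e y (Fin.last n) = t}.Countable := by
  choose φ hφ hφx using F.cover
  obtain ⟨S, hS, hSM⟩ := TopologicalSpace.countable_cover_nhds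
    fun x => (φ x).open_source.mem_nhds (hφx x)
  let A := insert e (φ '' S)
  have hA : A.Countable := (hS.image φ).insert e
  have hAF : A ⊆ F.atlas := by
    rintro _ (rfl | ⟨x, -, rfl⟩)
    exacts [he, hφ x]
  have hcov : ∀ x, ∃ e ∈ A, x ∈ e.source := by
    intro x
    obtain ⟨y, hy, hxy⟩ := mem_iUnion₂.1 (hSM ▸ mem_univ x)
    exact ⟨φ y, mem_insert_of_mem _ ⟨y, hy, rfl⟩, hxy⟩
  obtain ⟨i, hiA, hi⟩ := hcov w
  have hcount := Set.Countable.setOf_reflTransGen (countable_setOf_plaqueAdj hA hAF)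
    (⟨i, hiA⟩, i w (Fin.last n))
  refine (hcount.image Prod.snd).mono ?_
  rintro t ⟨L, ⟨z, rfl⟩, ⟨c, hc, hc0, hcw⟩, y, ⟨⟨c', hc', hc0', hcy⟩, hy⟩, rfl⟩
  obtain ⟨k, hkA, hk⟩ := hcov z
  refine ⟨(⟨e, mem_insert ..⟩, e y (Fin.last n)), ?_, rfl⟩
  subst hcw hcy
  -- The chain follows `c` backwards from `w` to the base point `z` of the leaf, then `c'` forwards
  -- to `y`.
  refine Relation.ReflTransGen.trans
    (hc.reflTransGen_plaqueAdj hAF hcov ⟨i, hiA⟩ ⟨k, hkA⟩ (b := 0) hi (by rwa [hc0])) ?_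
  have := hc'.reflTransGen_plaqueAdj hAF hcov ⟨k, hkA⟩ ⟨e, mem_insert ..⟩ (a := 0)
    (by rwa [hc0']) hy
  rw [hc0'] at this
  rwa [hc0]

end Plaques

end CodimOneFoliation

/-! ### Local flows and the infinitesimal form of preservation -/

/-- The local flow of a `C¹` vector field, for small positive times. -/
theorem ContDiffAt.exists_flow_mem {E : Type*} [NormedAddCommGroup E] [NormedSpace ℝ E]
    [CompleteSpace E] {X : E → E} {p : E} (hX : ContDiffAt ℝ 1 X p) {U : Set E} (hU : U ∈ 𝓝 p) :
    ∃ δ > 0, ∃ η > 0, ∃ α : E × ℝ → E, ContinuousOn α (Metric.ball p δ ×ˢ Icc 0 η) ∧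
      ∀ q ∈ Metric.ball p δ, α (q, 0) = q ∧ ∀ t ∈ Icc 0 η, α (q, t) ∈ U ∧
        HasDerivWithinAt (fun t => α (q, t)) (X (α (q, t))) (Icc 0 η) t := by
  obtain ⟨ε, hε, a, r, L, K, hr, hpl⟩ := IsPicardLindelof.of_contDiffAt_one hX
  obtain ⟨α, hα, hαc⟩ :=
    (hpl 0).exists_forall_mem_closedBall_eq_hasDerivWithinAt_continuousOn
  have hp : p ∈ Metric.closedBall p (r : ℝ) := Metric.mem_closedBall_self hr.le
  have h0 : (0 : ℝ) ∈ Icc (0 - ε) (0 + ε) := by constructor <;> linarith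
  have hαp : α (p, 0) = p := (hα p hp).1
  -- Joint continuity at `(p, 0)` keeps the flow in `U` on a ball of radius `ρ`; the later choice `ρ
  -- / 2` puts a closed time interval inside it.
  have hev : ∀ᶠ z in 𝓝[Metric.closedBall p (r : ℝ) ×ˢ Icc (0 - ε) (0 + ε)] (p, (0 : ℝ)),
      α z ∈ U := (hαc (p, 0) ⟨hp, h0⟩).eventually_mem (by rwa [hαp])
  rw [nhdsWithin_prod_eq, nhdsWithin_eq_nhds.2 (Metric.closedBall_mem_nhds p (NNReal.coe_pos.2 hr)),
    nhdsWithin_eq_nhds.2 (Icc_mem_nhds (by linarith) (by linarith)),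
    ← nhds_prod_eq, Metric.eventually_nhds_iff_ball] at hev
  obtain ⟨ρ, hρ, hρU⟩ := hev
  have hsub : Icc 0 (min ε (ρ / 2)) ⊆ Icc (0 - ε) (0 + ε) := fun t ht => by
    have := min_le_left ε (ρ / 2)
    constructor <;> linarith [ht.1, ht.2]
  have hball : Metric.ball p (min (r : ℝ) ρ) ⊆ Metric.closedBall p (r : ℝ) :=
    (Metric.ball_subset_ball (min_le_left _ _)).trans Metric.ball_subset_closedBall
  refine ⟨min r ρ, lt_min hr hρ, min ε (ρ / 2), lt_min hε (by linarith), α,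
    hαc.mono (prod_mono hball hsub), fun q hq => ?_⟩
  refine ⟨(hα q (hball hq)).1, fun t ht => ⟨hρU _ ?_, ((hα q (hball hq)).2 t (hsub ht)).mono hsub⟩⟩
  rw [← ball_prod_same]
  refine ⟨Metric.ball_subset_ball (min_le_right _ _) hq, ?_⟩
  have := min_le_right ε (ρ / 2)
  rw [Metric.mem_ball, Real.dist_eq, sub_zero, abs_of_nonneg ht.1]
  linarith [ht.2]

section Flow

variable {n : ℕ} {M : Type*} [TopologicalSpace M]
  [ChartedSpace (EuclideanSpace ℝ (Fin (n + 1))) M] [IsManifold (𝓡 (n + 1)) ∞ M]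

theorem hasMFDerivWithinAt_chart_symm
    {e : OpenPartialHomeomorph M (EuclideanSpace ℝ (Fin (n + 1)))}
    (he : e ∈ IsManifold.maximalAtlas (𝓡 (n + 1)) ∞ M)
    {V : Π x : M, TangentSpace (𝓡 (n + 1)) x} {γ : ℝ → EuclideanSpace ℝ (Fin (n + 1))}
    {s : Set ℝ} {t : ℝ} (hγ : HasDerivWithinAt γ (chartField e V (γ t)) s t)
    (ht : γ t ∈ e.target) :
    HasMFDerivWithinAt 𝓘(ℝ, ℝ) (𝓡 (n + 1)) (fun t => e.symm (γ t)) s t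
      ((1 : ℝ →L[ℝ] ℝ).smulRight (V (e.symm (γ t)))) := by
  have h1 := ((mdifferentiable_of_mem_maximalAtlas he).mdifferentiableAt_symm ht).hasMFDerivAt
  have h2 := h1.comp_hasMFDerivWithinAt t hγ.hasFDerivWithinAt.hasMFDerivWithinAt
  have h3 : mfderiv (𝓡 (n + 1)) (𝓡 (n + 1)) e.symm (γ t) (chartField e V (γ t))
      = V (e.symm (γ t)) := (mfderiv_chart_comp_symm he ht).1.self_apply_inverse _
  refine h2.congr_mfderiv ?_
  ext1
  refine Eq.trans ?_ ((congrArg (fun w : TangentSpace (𝓡 (n + 1)) (e.symm (γ t)) =>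
    (1 : ℝ) • w) h3))
  rw [one_smul]
  exact congrArg (mfderiv (𝓡 (n + 1)) (𝓡 (n + 1)) e.symm (γ t)) (one_smul ℝ _)

namespace CodimOneFoliation

variable {F : CodimOneFoliation n M}

theorem isLeafCurve_chart_symm {e : OpenPartialHomeomorph M (EuclideanSpace ℝ (Fin (n + 1)))}
    (he : e ∈ F.atlas) {γ : unitInterval → EuclideanSpace ℝ (Fin (n + 1))} (hγ : Continuous γ)
    (ht : ∀ s, γ s ∈ e.target) {a : ℝ} (ha : ∀ s, γ s (Fin.last n) = a) :
    F.IsLeafCurve fun s => e.symm (γ s) := by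
  have hc : Continuous fun s => e.symm (γ s) :=
    e.continuousOn_symm.comp_continuous hγ ht
  refine ⟨hc, fun s e' he' hs => ?_⟩
  obtain ⟨h, hh⟩ := F.compatible e he e' he' _ ⟨e.map_target (ht s), hs⟩
  have hs0 := hh.self_of_nhds
  filter_upwards [hc.continuousAt.eventually hh] with s' hs'
  rw [hs', hs0, e.right_inv (ht s), e.right_inv (ht s'), ha, ha]

/-- The flow moves a segment of a plaque into a single leaf. The last coordinate along the moved
segment is continuous with countably many possible values, hence constant. Differentiating in time
at `0` shows that the last component of `V` is constant along the segment. -/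
theorem PreservedBy.mvfderiv_mvfderiv_lastCoord [SecondCountableTopology M]
    {V : Π x : M, TangentSpace (𝓡 (n + 1)) x} (hVF : F.PreservedBy V)
    (hV : ContMDiff (𝓡 (n + 1)) (𝓡 (n + 1)).tangent ∞ (T% V))
    {e : OpenPartialHomeomorph M (EuclideanSpace ℝ (Fin (n + 1)))} (he : e ∈ F.atlas) {x : M}
    (hx : x ∈ e.source) {v : TangentSpace (𝓡 (n + 1)) x} (hv : v ∈ F.tangent x) :
    mvfderiv (𝓡 (n + 1))
      (fun y => mvfderiv (𝓡 (n + 1)) (fun y => e y (Fin.last n)) y (V y)) x v = 0 := by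
  have hem := F.smooth e he
  rw [F.mem_tangent_iff he hx, mvfderiv_lastCoord hem hx] at hv
  have hline := hasDerivAt_chart_line hem hx (mdifferentiableAt_mvfderiv_apply
    ((contMDiffAt_lastCoord hem hx).of_le ENat.LEInfty.out)
    ((hV x).mdifferentiableAt (by simp))) v
  refine hline.unique ?_
  set ξ : EuclideanSpace ℝ (Fin (n + 1)) := mvfderiv (𝓡 (n + 1)) e x v with hξ
  obtain ⟨δ, hδ, η, hη, α, hαc, hα⟩ := (contDiffAt_chartField hem hx
    ((hV x).of_le ENat.LEInfty.out)).exists_flow_mem (e.open_target.mem_nhds (e.map_source hx))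
  let q : ℝ → EuclideanSpace ℝ (Fin (n + 1)) := fun s => e x + s • ξ
  have hq : Continuous q := by fun_prop
  have hq0 : q 0 = e x := by simp [q]
  have hqlast : ∀ s, q s (Fin.last n) = e x (Fin.last n) := fun s => by simp [q, hv]
  -- The whole segment from `e x` to `q s` must lie in the domain of the flow, since it serves as
  -- the leaf curve to be moved.
  have hqball : ∀ {s : ℝ}, q s ∈ Metric.ball (e x) δ → ∀ u : unitInterval,
      q (u * s) ∈ Metric.ball (e x) δ := by
    intro s hs u
    simp only [q, mem_ball_iff_norm, add_sub_cancel_left, norm_smul] at hs ⊢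
    refine lt_of_le_of_lt ?_ hs
    gcongr
    rw [norm_mul]
    exact mul_le_of_le_one_left (norm_nonneg _) (by
      rw [Real.norm_of_nonneg u.2.1]; exact u.2.2)
  have hmem : ∀ T ∈ Icc 0 η, ∀ s, q s ∈ Metric.ball (e x) δ →
      ∃ L, F.IsLeaf L ∧ e.symm (α (e x, T)) ∈ L ∧ e.symm (α (q s, T)) ∈ L := by
    intro T hT s hs
    have hTsub : uIcc 0 T ⊆ Icc 0 η := by
      rw [uIcc_of_le hT.1]
      exact Icc_subset_Icc_right hT.2
    have h := hVF T (fun u t => e.symm (α (q (u * s), t))) ?_ ?_ ?_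
    · simpa [hq0] using h
    · refine e.continuousOn_symm.comp (hαc.comp (f := fun z : unitInterval × ℝ =>
        (q (z.1 * s), z.2)) (by fun_prop) fun z hz => ⟨hqball hs z.1, hTsub hz.2⟩) fun z hz => ?_
      exact ((hα _ (hqball hs z.1)).2 _ (hTsub hz.2)).1
    · simp only [(hα _ (hqball hs _)).1]
      refine isLeafCurve_chart_symm he (by fun_prop) (fun u => ?_) (fun u => hqlast _)
      have := ((hα _ (hqball hs u)).2 0 ⟨le_rfl, hη.le⟩).1
      rwa [(hα _ (hqball hs _)).1] at this
    · intro u t ht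
      have := (hα _ (hqball hs u)).2 t (hTsub ht)
      exact hasMFDerivWithinAt_chart_symm hem (this.2.mono hTsub) this.1
  let J : Set ℝ := q ⁻¹' Metric.ball (e x) δ
  have hJ0 : (0 : ℝ) ∈ J := by simpa [J, hq0] using hδ
  have hconst : ∀ T ∈ Icc 0 η, ∀ s ∈ J, α (q s, T) (Fin.last n) = α (e x, T) (Fin.last n) := by
    intro T hT s hs
    have hcount := countable_lastCoord_of_mem_leaf (e.symm (α (e x, T))) he
    let β : unitInterval → ℝ := fun u => α (q (u * s), T) (Fin.last n)
    have hβc : Continuous β := by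
      refine (EuclideanSpace.proj (𝕜 := ℝ) (Fin.last n)).continuous.comp
        (hαc.comp_continuous (f := fun u : unitInterval => (q (u * s), T)) (by fun_prop)
          fun u => ⟨hqball hs u, hT⟩)
    have hβr : range β ⊆ {t : ℝ | ∃ L, F.IsLeaf L ∧ e.symm (α (e x, T)) ∈ L ∧
        ∃ y ∈ L ∩ e.source, e y (Fin.last n) = t} := by
      rintro _ ⟨u, rfl⟩
      obtain ⟨L, hL, h1, h2⟩ := hmem T hT _ (hqball hs u)
      have ht := ((hα _ (hqball hs u)).2 T hT).1
      exact ⟨L, hL, h1, _, ⟨h2, e.map_target ht⟩, by rw [e.right_inv ht]⟩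
    -- A countable set of reals is totally disconnected, and `range β` is connected.
    have := hcount.isTotallyDisconnected (range β) hβr
      (isPreconnected_range hβc) (mem_range_self 1) (mem_range_self 0)
    simpa [β, hq0] using this
  have hderiv : ∀ s ∈ J, HasDerivWithinAt (fun T => α (q s, T) (Fin.last n))
      (chartField e V (q s) (Fin.last n)) (Icc 0 η) 0 := by
    intro s hs
    have h := ((hα _ hs).2 0 ⟨le_rfl, hη.le⟩).2
    rw [(hα _ hs).1] at h
    exact (EuclideanSpace.proj (𝕜 := ℝ) (Fin.last n)).hasFDerivAt.comp_hasDerivWithinAt 0 h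
  refine (hasDerivAt_const (0 : ℝ) (chartField e V (e x) (Fin.last n))).congr_of_eventuallyEq ?_
  filter_upwards [(Metric.isOpen_ball.preimage hq).mem_nhds hJ0] with s hs
  have ht : q s ∈ e.target := by
    have := ((hα _ hs).2 0 ⟨le_rfl, hη.le⟩).1
    rwa [(hα _ hs).1] at this
  rw [← chartField_apply_last hem V ht]
  have h0 := hderiv 0 hJ0
  rw [hq0] at h0
  -- The flow is only available for times in `[0, η]`, so the velocities are compared as one-sided
  -- derivatives at `0`.
  refine (uniqueDiffOn_Icc hη 0 ⟨le_rfl, hη.le⟩).eq_deriv _ ((hderiv s hs).congr_of_mem ?_ ?_) h0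
  · exact fun T hT => (hconst T hT s hs).symm
  · exact ⟨le_rfl, hη.le⟩

end CodimOneFoliation

end Flow

/-! ### Variation of the shape operator along the normal part -/

section LeviCivitaSum

variable {E : Type*} [NormedAddCommGroup E] [NormedSpace ℝ E] [FiniteDimensional ℝ E]
  {H : Type*} [TopologicalSpace H] {I : ModelWithCorners ℝ E H}
  {M : Type*} [TopologicalSpace M] [ChartedSpace H M] [IsManifold I ∞ M]
  [RiemannianBundle (fun x : M => TangentSpace I x)]
  [IsContMDiffRiemannianBundle I ∞ E (fun x : M => TangentSpace I x)]

theorem leviCivita_sum_smul {κ : Type*} {X : κ → Π x : M, TangentSpace I x} {c : κ → M → ℝ} {x : M}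
    (hc : ∀ i, MDiffAt (c i) x) (hX : ∀ i, MDiffAt (T% (X i)) x) (s : Finset κ)
    (v : TangentSpace I x) :
    leviCivita I M (fun y => ∑ i ∈ s, c i y • X i y) x v
      = ∑ i ∈ s, (c i x • leviCivita I M (X i) x v + mvfderiv I (c i) x v • X i x) := by
  classical
  induction s using Finset.induction_on with
  | empty =>
    have h := leviCivita_smul (f := fun _ => (0 : ℝ)) (Y := 0) (x := x)
      mdifferentiableAt_const (mdifferentiable_zeroSection _ _ _) v
    refine Eq.trans (congrArg (fun Y => leviCivita I M Y x v) ?_) (h.trans ?_)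
    · ext y
      simp
    · simp [mvfderiv_const]
  | insert i s hi ih =>
    have h1 : MDiffAt (T% (c i • X i)) x := (hc i).smul_section (hX i)
    have h2 : MDiffAt (T% (fun y => ∑ i ∈ s, c i y • X i y)) x :=
      .sum_section fun i _ => (hc i).smul_section (hX i)
    have h3 : (fun y => ∑ j ∈ insert i s, c j y • X j y)
        = c i • X i + fun y => ∑ i ∈ s, c i y • X i y := by
      ext1 y
      rw [Finset.sum_insert hi]
      rfl
    rw [h3, leviCivita_add h1 h2, add_apply, ih,
      leviCivita_smul (hc i) (hX i), Finset.sum_insert hi]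

theorem leviCivita_smul_vec {Y : Π x : M, TangentSpace I x} {x : M} (a : ℝ)
    (v : TangentSpace I x) : leviCivita I M Y x (a • v) = a • leviCivita I M Y x v :=
  map_smul _ _ _

end LeviCivitaSum

namespace CodimOneFoliation

section Variation

variable {n : ℕ} {M : Type*} [TopologicalSpace M]
  [ChartedSpace (EuclideanSpace ℝ (Fin (n + 1))) M] [IsManifold (𝓡 (n + 1)) ∞ M]
  [RiemannianBundle (fun x : M => TangentSpace (𝓡 (n + 1)) x)]
  [IsContMDiffRiemannianBundle (𝓡 (n + 1)) ∞ (EuclideanSpace ℝ (Fin (n + 1)))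
    (fun x : M => TangentSpace (𝓡 (n + 1)) x)]
  {F : CodimOneFoliation n M} {N V : Π x : M, TangentSpace (𝓡 (n + 1)) x}

theorem IsUnitNormal.contMDiff_inner (hN : F.IsUnitNormal N)
    (hV : ContMDiff (𝓡 (n + 1)) (𝓡 (n + 1)).tangent ∞ (T% V)) :
    ContMDiff (𝓡 (n + 1)) 𝓘(ℝ) ∞ (fun y => (inner ℝ (V y) (N y) : ℝ)) := fun x =>
  ContMDiffAt.inner_bundle (E := fun x : M => TangentSpace (𝓡 (n + 1)) x) (hV x) (hN.smooth x)

theorem IsUnitNormal.contMDiff_normalPart (hN : F.IsUnitNormal N)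
    (hV : ContMDiff (𝓡 (n + 1)) (𝓡 (n + 1)).tangent ∞ (T% V)) :
    ContMDiff (𝓡 (n + 1)) (𝓡 (n + 1)).tangent ∞ (T% (F.normalPart V)) := by
  rw [hN.normalPart_eq]
  exact fun x => (hN.contMDiff_inner hV x).smul_section (hN.smooth x)

/-- The bracket of the normal part of a field that preserves the foliation with a tangent field
is tangent. -/
theorem PreservedBy.mlieBracket_normalPart_mem [SecondCountableTopology M]
    (hVF : F.PreservedBy V) (hV : ContMDiff (𝓡 (n + 1)) (𝓡 (n + 1)).tangent ∞ (T% V))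
    (hN : F.IsUnitNormal N) {X : Π x : M, TangentSpace (𝓡 (n + 1)) x} {x : M}
    (hX : MDifferentiableAt (𝓡 (n + 1)) (𝓡 (n + 1)).tangent (T% X) x)
    (hXt : ∀ᶠ y in 𝓝 x, X y ∈ F.tangent y) :
    VectorField.mlieBracket (𝓡 (n + 1)) (F.normalPart V) X x ∈ F.tangent x := by
  obtain ⟨e, he, hx⟩ := F.cover x
  have hW := (hN.contMDiff_normalPart hV x).mdifferentiableAt (by simp)
  rw [F.mem_tangent_iff he hx, mvfderiv_lastCoord_mlieBracket (F.smooth e he) hx hW hX,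
    mvfderiv_congr (g' := fun _ => 0), mvfderiv_const,
    mvfderiv_congr (g' := fun y => mvfderiv (𝓡 (n + 1)) (fun y => e y (Fin.last n)) y (V y)),
    hVF.mvfderiv_mvfderiv_lastCoord hV he hx hXt.self_of_nhds]
  · simp
  -- `V` and its normal part differ by a tangent vector, which does not change the last coordinate.
  · filter_upwards [e.open_source.mem_nhds hx] with y hy
    rw [normalPart, map_sub, (F.mem_tangent_iff he hy).1 (F.tangentPart y (V y)).2, sub_zero]
  · filter_upwards [hXt, e.open_source.mem_nhds hx] with y hy hy'
    exact (F.mem_tangent_iff he hy').1 hy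

/-- For a tangent extension `X` of `v` and `W = f N`, expanding `⟨[W, X], N⟩ = 0` gives `-f ⟨X, ∇_N
N⟩ - X f = 0`. -/
theorem PreservedBy.mvfderiv_inner_normal [SecondCountableTopology M]
    (hVF : F.PreservedBy V) (hV : ContMDiff (𝓡 (n + 1)) (𝓡 (n + 1)).tangent ∞ (T% V))
    (hN : F.IsUnitNormal N) {x : M} (v : F.tangent x) :
    mvfderiv (𝓡 (n + 1)) (fun y => (inner ℝ (V y) (N y) : ℝ)) x
        (v : TangentSpace (𝓡 (n + 1)) x)
      = -(inner ℝ (V x) (N x) * inner ℝ (leviCivita (𝓡 (n + 1)) M N x (N x))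
        (v : TangentSpace (𝓡 (n + 1)) x)) := by
  have hX := hN.mdifferentiableAt_tangentExtend (v : TangentSpace (𝓡 (n + 1)) x)
  have hXt := hN.tangentExtend_mem (v : TangentSpace (𝓡 (n + 1)) x)
  have hW := (hN.contMDiff_normalPart hV x).mdifferentiableAt (by simp)
  have hb := hVF.mlieBracket_normalPart_mem hV hN hX (.of_forall hXt)
  rw [hN.mem_tangent_iff_inner, mlieBracket_eq_leviCivita hW hX, inner_sub_left] at hb
  have h1 := leviCivita_metric hW hX (hN.mdifferentiableAt x)
  have h0 : (fun y => (inner ℝ (tangentExtend N (v : TangentSpace (𝓡 (n + 1)) x) y) (N y) : ℝ))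
      = fun _ => 0 := by
    ext y
    exact hN.mem_tangent_iff_inner.1 (hXt y)
  rw [h0, mvfderiv_const] at h1
  rw [hN.tangentExtend_self] at h1 hb
  rw [hN.normalPart_eq] at h1 hb
  rw [leviCivita_smul ((hN.contMDiff_inner hV x).mdifferentiableAt (by simp))
    (hN.mdifferentiableAt x), inner_add_left, inner_smul_left, inner_smul_left, hN.inner_self,
    hN.inner_leviCivita] at hb
  simp only [Pi.smul_apply', leviCivita_smul_vec, inner_smul_right] at h1 hb
  rw [real_inner_comm (v : TangentSpace (𝓡 (n + 1)) x)]
  simp at h1 hb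
  linarith

/-- An equality of fields on all of `M`, so it may be differentiated: the Hessian of `f` becomes a
covariant derivative of `-f ∇_N N`. -/
theorem PreservedBy.coe_leafGradient [SecondCountableTopology M]
    (hVF : F.PreservedBy V) (hV : ContMDiff (𝓡 (n + 1)) (𝓡 (n + 1)).tangent ∞ (T% V))
    (hN : F.IsUnitNormal N) :
    (fun x => (F.leafGradient (fun y => (inner ℝ (V y) (N y) : ℝ)) x :
        TangentSpace (𝓡 (n + 1)) x))
      = -((fun y => (inner ℝ (V y) (N y) : ℝ)) • fun x => leviCivita (𝓡 (n + 1)) M N x (N x)) := by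
  ext1 x
  have hZ : leviCivita (𝓡 (n + 1)) M N x (N x) ∈ F.tangent x :=
    hN.mem_tangent_iff_inner.2 (hN.inner_leviCivita _)
  have h : F.leafGradient (fun y => (inner ℝ (V y) (N y) : ℝ)) x
      = -((inner ℝ (V x) (N x) : ℝ) • (⟨_, hZ⟩ : F.tangent x)) := by
    refine ext_inner_right ℝ fun v => ?_
    rw [leafGradient, InnerProductSpace.toDual_symm_apply]
    refine (hVF.mvfderiv_inner_normal hV hN v).trans ?_
    rw [inner_neg_left]
    exact congrArg Neg.neg (real_inner_smul_left _ _ _).symm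
  rw [h]
  rfl

/-- The Lie derivative of the shape operator along the normal part of a field that preserves the
foliation. -/
theorem PreservedBy.lieDerivative_shape [SecondCountableTopology M]
    (hVF : F.PreservedBy V) (hV : ContMDiff (𝓡 (n + 1)) (𝓡 (n + 1)).tangent ∞ (T% V))
    (hN : F.IsUnitNormal N) {X : Π x : M, TangentSpace (𝓡 (n + 1)) x} {x : M}
    (hX : MDifferentiableAt (𝓡 (n + 1)) (𝓡 (n + 1)).tangent (T% X) x) :
    VectorField.mlieBracket (𝓡 (n + 1)) (F.normalPart V)
        (-fun y => leviCivita (𝓡 (n + 1)) M N y (X y)) x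
      + leviCivita (𝓡 (n + 1)) M N x
          (VectorField.mlieBracket (𝓡 (n + 1)) (F.normalPart V) X x)
      = (inner ℝ (V x) (N x) : ℝ) • riemannCurvature (𝓡 (n + 1)) X N N x
        + leviCivita (𝓡 (n + 1)) M
          (fun y => (F.leafGradient (fun y => (inner ℝ (V y) (N y) : ℝ)) y :
            TangentSpace (𝓡 (n + 1)) y)) x (X x)
        + (inner ℝ (V x) (N x) : ℝ) • leviCivita (𝓡 (n + 1)) M N x
          (leviCivita (𝓡 (n + 1)) M N x (X x))
        + mvfderiv (𝓡 (n + 1)) (fun y => (inner ℝ (V y) (N y) : ℝ)) x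
          (leviCivita (𝓡 (n + 1)) M N x (X x)) • N x := by
  have hW := (hN.contMDiff_normalPart hV x).mdifferentiableAt (by simp)
  have hf := (hN.contMDiff_inner hV x).mdifferentiableAt (by simp)
  have hNd := hN.mdifferentiableAt x
  have hAX := mdifferentiableAt_leviCivita hX (hN.contMDiffAt_two x)
  have hZ := mdifferentiableAt_leviCivita hNd (hN.contMDiffAt_two x)
  have hAX' := mdifferentiableAt_neg_section hAX
  -- With brackets written as differences of covariant derivatives, the term `f ∇_X ∇_N N` of the
  -- curvature cancels the same term from the gradient, and the rest is linear algebra.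
  rw [hVF.coe_leafGradient hV hN, riemannCurvature, leviCivita_neg (hf.smul_section hZ),
    mlieBracket_eq_leviCivita hW hAX', mlieBracket_eq_leviCivita hW hX,
    mlieBracket_eq_leviCivita hX hNd, leviCivita_neg hAX]
  rw [hN.normalPart_eq]
  simp only [leviCivita_smul hf hNd, leviCivita_smul hf hZ, neg_apply,
    map_sub, map_add, map_smul, map_neg, Pi.smul_apply', Pi.neg_apply]
  module

end Variation

end CodimOneFoliation

/-- Cyclicity of the trace and `A T = T A` give `Tr(T D A) = Tr(T A D)`. This removes the dependence
on how the frame moves. -/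
theorem LinearMap.trace_comp_add_commutator {R U : Type*} [CommRing R] [AddCommGroup U] [Module R U]
    {A T : U →ₗ[R] U} (h : Commute A T) (D P : U →ₗ[R] U) :
    LinearMap.trace R U (T ∘ₗ (P + D ∘ₗ A - A ∘ₗ D)) = LinearMap.trace R U (T ∘ₗ P) := by
  have h1 : LinearMap.trace R U (T * (D * A)) = LinearMap.trace R U (T * (A * D)) := by
    rw [← mul_assoc, LinearMap.trace_mul_comm, ← mul_assoc, h.eq, mul_assoc]
  simp only [← Module.End.mul_eq_comp, mul_sub, mul_add, map_sub, map_add, h1]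
  abel

/-! ### The Jacobi operator as a derivative of the mean curvature -/

namespace CodimOneFoliation

section Jacobi

variable {n : ℕ} {M : Type*} [TopologicalSpace M]
  [ChartedSpace (EuclideanSpace ℝ (Fin (n + 1))) M] [IsManifold (𝓡 (n + 1)) ∞ M]
  [RiemannianBundle (fun x : M => TangentSpace (𝓡 (n + 1)) x)]
  [IsContMDiffRiemannianBundle (𝓡 (n + 1)) ∞ (EuclideanSpace ℝ (Fin (n + 1)))
    (fun x : M => TangentSpace (𝓡 (n + 1)) x)]
  {F : CodimOneFoliation n M} {N V : Π x : M, TangentSpace (𝓡 (n + 1)) x}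

/-- The matrices of the shape operators in a local frame of the leaves. -/
theorem IsUnitNormal.exists_shape_matrix (hN : F.IsUnitNormal N) {x : M} {κ : Type*} [Fintype κ]
    [DecidableEq κ] (b : Module.Basis κ ℝ (F.tangent x)) :
    ∃ c : κ → κ → M → ℝ, (∀ i j, MDifferentiableAt (𝓡 (n + 1)) 𝓘(ℝ) (c i j) x) ∧ ∀ᶠ y in 𝓝 x,
      (∀ j, -leviCivita (𝓡 (n + 1)) M N y
          (tangentExtend N (b j : TangentSpace (𝓡 (n + 1)) x) y)
        = ∑ i, c i j y • tangentExtend N (b i : TangentSpace (𝓡 (n + 1)) x) y) ∧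
      ∀ k, F.meanCurvature N k y = (Matrix.of fun i j => c i j y).eigenEsymm k := by
  let X : κ → Π y : M, TangentSpace (𝓡 (n + 1)) y := fun j =>
    tangentExtend N (b j : TangentSpace (𝓡 (n + 1)) x)
  have hX : ∀ j, MDifferentiableAt (𝓡 (n + 1)) (𝓡 (n + 1)).tangent (T% (X j)) x :=
    fun j => hN.mdifferentiableAt_tangentExtend _
  have hXt : ∀ j y, X j y ∈ F.tangent y := fun j => hN.tangentExtend_mem _
  have hli : LinearIndependent ℝ (fun j => X j x) := by
    simp only [X, hN.tangentExtend_self]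
    exact b.linearIndependent.map' (F.tangent x).subtype (Submodule.ker_subtype _)
  have hAX : ∀ j, MDifferentiableAt (𝓡 (n + 1)) (𝓡 (n + 1)).tangent
      (T% (-fun y => leviCivita (𝓡 (n + 1)) M N y (X j y))) x := fun j =>
    mdifferentiableAt_neg_section (mdifferentiableAt_leviCivita (hX j) (hN.contMDiffAt_two x))
  choose c hc hcX using fun j =>
    exists_mdifferentiableAt_coeff hX hli fun i => mdiffAt_inner (hX i) (hAX j)
  -- The indices are swapped so that the coefficients of the `j`-th image form the `j`-th column.
  refine ⟨fun i j => c j i, fun i j => hc j i, ?_⟩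
  filter_upwards [Filter.eventually_all.2 hcX, eventually_linearIndependent hX hli] with y hy hl
  have hl' : LinearIndependent ℝ (fun j => (⟨X j y, hXt j y⟩ : F.tangent y)) :=
    LinearIndependent.of_comp (F.tangent y).subtype hl
  have hcard : Fintype.card κ = Module.finrank ℝ (F.tangent y) := by
    rw [F.finrank_tangent, ← F.finrank_tangent x, Module.finrank_eq_card_basis b]
  let B := basisOfTopLeSpanOfCardEqFinrank _ (hl'.span_eq_top_of_card_eq_finrank' hcard).ge hcard
  have hB : ∀ j, B j = ⟨X j y, hXt j y⟩ := fun j => by simp [B]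
  have hsh : ∀ j, (F.shape N y (B j) : TangentSpace (𝓡 (n + 1)) y)
      = -leviCivita (𝓡 (n + 1)) M N y (X j y) := fun j => by
    rw [hN.coe_shape, hB]
  have hspan : ∀ v : F.tangent y, (v : TangentSpace (𝓡 (n + 1)) y)
      ∈ Submodule.span ℝ (range fun i => X i y) := by
    intro v
    rw [← B.sum_repr v, Submodule.coe_sum]
    refine Submodule.sum_mem _ fun i _ => Submodule.smul_mem _ _ (Submodule.subset_span ⟨i, ?_⟩)
    rw [hB]
  have hsum : ∀ j, -leviCivita (𝓡 (n + 1)) M N y (X j y) = ∑ i, c j i y • X i y := by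
    intro j
    refine hy j ?_
    rw [Pi.neg_apply, ← hsh]
    exact hspan _
  refine ⟨hsum, fun k => ?_⟩
  rw [hN.meanCurvature_eq B]
  congr 1
  ext i j
  have h : F.shape N y (B j) = ∑ i, c j i y • B i := by
    ext1
    rw [hsh, hsum, Submodule.coe_sum]
    refine Finset.sum_congr rfl fun i _ => ?_
    rw [hB]
    rfl
  rw [LinearMap.toMatrix_apply, h, B.repr_sum_self]
  rfl

/-- The operator `R(N)v = (R(v, N)N)^⊤` on the tangent space of the leaf. -/
noncomputable def normalCurvature (hN : F.IsUnitNormal N) (x : M) :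
    F.tangent x →ₗ[ℝ] F.tangent x :=
  F.tangentPart x ∘ₗ (TensorialAt.mkHom (fun X => riemannCurvature (𝓡 (n + 1)) X N N x) x
    (riemannCurvature_tensorial (hN.contMDiffAt_two x))).toLinearMap ∘ₗ (F.tangent x).subtype

/-- Tensoriality allows any differentiable extension of `v`: `traceCurvature` uses the one from the
bundle, the frame argument one tangent to the leaves. -/
theorem normalCurvature_apply (hN : F.IsUnitNormal N) {x : M} (v : F.tangent x)
    {X : Π x : M, TangentSpace (𝓡 (n + 1)) x}
    (hX : MDifferentiableAt (𝓡 (n + 1)) (𝓡 (n + 1)).tangent (T% X) x) (hv : X x = v) :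
    normalCurvature hN x v = F.tangentPart x (riemannCurvature (𝓡 (n + 1)) X N N x) := by
  have h := TensorialAt.mkHom_apply (riemannCurvature_tensorial (Y := N) (hN.contMDiffAt_two x)) hX
  rw [hv] at h
  exact congrArg (F.tangentPart x) h

theorem traceCurvature_eq (hN : F.IsUnitNormal N) (r : ℕ) (x : M) :
    F.traceCurvature N r x
      = LinearMap.trace ℝ (F.tangent x) (normalCurvature hN x ∘ₗ F.newton N x r) := by
  rw [LinearMap.trace_eq_sum_inner _ (stdOrthonormalBasis ℝ (F.tangent x)), traceCurvature]
  refine Finset.sum_congr rfl fun i _ => ?_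
  rw [LinearMap.comp_apply, normalCurvature_apply hN (F.newton N x r _)
    (FiberBundle.mdifferentiableAt_extend ..) (FiberBundle.extend_apply_self ..)]
  exact (inner_tangentPart _ _).symm.trans (real_inner_comm _ _)

theorem opJ_eq_trace (hN : F.IsUnitNormal N) (r : ℕ) (f : M → ℝ) (x : M) :
    F.opJ N r f x = LinearMap.trace ℝ (F.tangent x) (F.newton N x r ∘ₗ
      (F.leafHessian f x + f x • (F.shape N x ∘ₗ F.shape N x)
        + f x • normalCurvature hN x)) := by
  rw [opJ, opL, traceCurvature_eq hN, LinearMap.trace_comp_comm' _ (normalCurvature hN x),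
    ← LinearMap.comp_assoc, LinearMap.trace_comp_comm' (F.newton N x r)]
  simp only [LinearMap.comp_add, LinearMap.comp_smul, map_add, map_smul, smul_eq_mul]
  ring

theorem IsUnitNormal.trace_newton_comp_toLin (hN : F.IsUnitNormal N) {x : M} {κ : Type*} [Fintype κ]
    [DecidableEq κ] (b : Module.Basis κ ℝ (F.tangent x)) {c : κ → κ → M → ℝ}
    (hc : ∀ i j, MDifferentiableAt (𝓡 (n + 1)) 𝓘(ℝ) (c i j) x)
    (hA : LinearMap.toMatrix b b (F.shape N x) = Matrix.of fun i j => c i j x) (r : ℕ)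
    (w : TangentSpace (𝓡 (n + 1)) x) :
    LinearMap.trace ℝ (F.tangent x) (F.newton N x r ∘ₗ
        Matrix.toLin b b (Matrix.of fun i j => mvfderiv (𝓡 (n + 1)) (c i j) x w))
      = mvfderiv (𝓡 (n + 1)) (fun y => (Matrix.of fun i j => c i j y).eigenEsymm (r + 1)) x w := by
  rw [LinearMap.trace_eq_matrix_trace ℝ b, LinearMap.toMatrix_comp b b b, LinearMap.toMatrix_toLin,
    hN.toMatrix_newton, hA, ← Matrix.fderiv_eigenEsymm]
  have h1 : ∀ i, MDifferentiableAt (𝓡 (n + 1)) 𝓘(ℝ, κ → ℝ) (fun y j => c i j y) x :=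
    fun i => mdifferentiableAt_pi (hc i)
  have h2 := mvfderiv_differentiable_comp (Matrix.differentiable_eigenEsymm (r + 1)).differentiableAt
    (mdifferentiableAt_pi h1) w
  have h3 : mvfderiv (𝓡 (n + 1)) (fun y i j => c i j y) x w
      = fun i j => mvfderiv (𝓡 (n + 1)) (c i j) x w := by
    ext i j
    rw [mvfderiv_pi h1, mvfderiv_pi (hc i)]
  rw [h3] at h2
  exact h2.symm

/-- The Lie derivative of the shape operator in a local frame of the leaves. -/
theorem mlieBracket_shape_frame {x : M} {κ : Type*} [Fintype κ] [DecidableEq κ]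
    (b : Module.Basis κ ℝ (F.tangent x)) {W : Π x : M, TangentSpace (𝓡 (n + 1)) x}
    (hW : MDifferentiableAt (𝓡 (n + 1)) (𝓡 (n + 1)).tangent (T% W) x)
    {X : κ → Π x : M, TangentSpace (𝓡 (n + 1)) x}
    (hX : ∀ i, MDifferentiableAt (𝓡 (n + 1)) (𝓡 (n + 1)).tangent (T% (X i)) x)
    (hXx : ∀ i, X i x = b i) {D : F.tangent x →ₗ[ℝ] F.tangent x}
    (hD : ∀ i, (D (b i) : TangentSpace (𝓡 (n + 1)) x)
      = VectorField.mlieBracket (𝓡 (n + 1)) W (X i) x)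
    {Y : Π x : M, TangentSpace (𝓡 (n + 1)) x}
    (hY : MDifferentiableAt (𝓡 (n + 1)) (𝓡 (n + 1)).tangent (T% Y) x) {c : κ → M → ℝ}
    (hc : ∀ i, MDifferentiableAt (𝓡 (n + 1)) 𝓘(ℝ) (c i) x)
    (hYX : ∀ᶠ y in 𝓝 x, Y y = ∑ i, c i y • X i y) :
    VectorField.mlieBracket (𝓡 (n + 1)) W Y x
      = (∑ i, mvfderiv (𝓡 (n + 1)) (c i) x (W x) • b i + D (∑ i, c i x • b i) :
        F.tangent x) := by
  have e1 := (congrArg (fun L : TangentSpace (𝓡 (n + 1)) x →L[ℝ] TangentSpace (𝓡 (n + 1)) x =>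
    L (W x)) (leviCivita_congr hY hYX)).trans (leviCivita_sum_smul hc hX Finset.univ (W x))
  have e2 : leviCivita (𝓡 (n + 1)) M W x (Y x)
      = ∑ i, c i x • leviCivita (𝓡 (n + 1)) M W x (X i x) := by
    rw [hYX.self_of_nhds, map_sum]
    exact Finset.sum_congr rfl fun i _ => map_smul _ _ _
  refine (mlieBracket_eq_leviCivita hW hY).trans ((congrArg₂ (· - ·) e1 e2).trans ?_)
  simp only [map_sum, map_smul, hD, Submodule.coe_add, Submodule.coe_sum,
    Submodule.coe_smul, mlieBracket_eq_leviCivita hW (hX _), smul_sub,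
    Finset.sum_add_distrib, Finset.sum_sub_distrib, hXx]
  abel

/-- The tangential projection of `PreservedBy.lieDerivative_shape`: the multiple of `N` drops out,
and `∇N = -A` on tangent vectors turns the twofold derivative into `A²`. -/
theorem PreservedBy.lieDerivative_shape_tangentPart [SecondCountableTopology M]
    (hVF : F.PreservedBy V) (hV : ContMDiff (𝓡 (n + 1)) (𝓡 (n + 1)).tangent ∞ (T% V))
    (hN : F.IsUnitNormal N) {X : Π x : M, TangentSpace (𝓡 (n + 1)) x} {x : M}
    (hX : MDifferentiableAt (𝓡 (n + 1)) (𝓡 (n + 1)).tangent (T% X) x) {u v w : F.tangent x}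
    (hv : X x = v) (hu : VectorField.mlieBracket (𝓡 (n + 1)) (F.normalPart V) X x = u)
    (hw : VectorField.mlieBracket (𝓡 (n + 1)) (F.normalPart V)
      (-fun y => leviCivita (𝓡 (n + 1)) M N y (X y)) x = w) :
    w - F.shape N x u = F.leafHessian (fun y => inner ℝ (V y) (N y)) x v
      + (inner ℝ (V x) (N x) : ℝ) • F.shape N x (F.shape N x v)
      + (inner ℝ (V x) (N x) : ℝ) • normalCurvature hN x v := by
  have h := congrArg (F.tangentPart x) (hVF.lieDerivative_shape hV hN hX)
  rw [hw, hu, hv] at h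
  have h3 : ∀ v : F.tangent x, leviCivita (𝓡 (n + 1)) M N x v
      = -(F.shape N x v : TangentSpace (𝓡 (n + 1)) x) := fun v => by
    rw [hN.coe_shape, neg_neg]
  have h6 : F.leafHessian (fun y => inner ℝ (V y) (N y)) x v
      = F.tangentPart x (leviCivita (𝓡 (n + 1)) M (fun y => (F.leafGradient
        (fun y => (inner ℝ (V y) (N y) : ℝ)) y : TangentSpace (𝓡 (n + 1)) y)) x v) := rfl
  rw [h3 u, h3 v, map_neg (leviCivita (𝓡 (n + 1)) M N x), h3, neg_neg] at h
  simp only [map_add, map_smul, hN.tangentPart_smul, map_neg, tangentPart_coe, add_zero,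
    ← h6, ← normalCurvature_apply hN v hX hv] at h
  rw [sub_eq_add_neg, h]
  abel

/-- By the Leibniz rule, `[W, A X_j]` is `∑ W(c i j) X_i` plus `D` applied to `A X_j`; subtracting
`A [W, X_j]` leaves the commutator. The operator `D` depends on the frame, but only its commutator
with `A` enters. -/
theorem PreservedBy.exists_commutator [SecondCountableTopology M]
    (hVF : F.PreservedBy V) (hV : ContMDiff (𝓡 (n + 1)) (𝓡 (n + 1)).tangent ∞ (T% V))
    (hN : F.IsUnitNormal N) {x : M} {κ : Type*} [Fintype κ] [DecidableEq κ]
    (b : Module.Basis κ ℝ (F.tangent x)) {c : κ → κ → M → ℝ}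
    (hc : ∀ i j, MDifferentiableAt (𝓡 (n + 1)) 𝓘(ℝ) (c i j) x)
    (hcX : ∀ᶠ y in 𝓝 x, ∀ j, -leviCivita (𝓡 (n + 1)) M N y
        (tangentExtend N (b j : TangentSpace (𝓡 (n + 1)) x) y)
      = ∑ i, c i j y • tangentExtend N (b i : TangentSpace (𝓡 (n + 1)) x) y)
    (hA : ∀ j, F.shape N x (b j) = ∑ i, c i j x • b i) :
    ∃ D : F.tangent x →ₗ[ℝ] F.tangent x, F.leafHessian (fun y => inner ℝ (V y) (N y)) x
        + (inner ℝ (V x) (N x) : ℝ) • (F.shape N x ∘ₗ F.shape N x)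
        + (inner ℝ (V x) (N x) : ℝ) • normalCurvature hN x
      = Matrix.toLin b b (Matrix.of fun i j =>
          mvfderiv (𝓡 (n + 1)) (c i j) x (F.normalPart V x))
        + D ∘ₗ F.shape N x - F.shape N x ∘ₗ D := by
  have hW := (hN.contMDiff_normalPart hV x).mdifferentiableAt (by simp)
  have hX := fun j => hN.mdifferentiableAt_tangentExtend (b j : TangentSpace (𝓡 (n + 1)) x)
  have hXx := fun j => hN.tangentExtend_self (b j)
  obtain ⟨D, hD⟩ : ∃ D : F.tangent x →ₗ[ℝ] F.tangent x, ∀ j,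
      (D (b j) : TangentSpace (𝓡 (n + 1)) x) = VectorField.mlieBracket (𝓡 (n + 1))
        (F.normalPart V) (tangentExtend N (b j : TangentSpace (𝓡 (n + 1)) x)) x :=
    ⟨b.constr ℝ fun j => ⟨_, hVF.mlieBracket_normalPart_mem hV hN (hX j)
      (.of_forall (hN.tangentExtend_mem _))⟩, fun j => congrArg Subtype.val (b.constr_basis ℝ _ j)⟩
  refine ⟨D, b.ext fun j => ?_⟩
  have h := hVF.lieDerivative_shape_tangentPart hV hN (hX j) (hXx j) (hD j).symm
    (mlieBracket_shape_frame b hW hX hXx hD (mdifferentiableAt_neg_section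
      (mdifferentiableAt_leviCivita (hX j) (hN.contMDiffAt_two x))) (fun i => hc i j)
      (hcX.mono fun y hy => hy j))
  have hP := Matrix.toLin_self b b
    (Matrix.of fun i j => mvfderiv (𝓡 (n + 1)) (c i j) x (F.normalPart V x)) j
  exact h.symm.trans (congrArg₂ (· - ·)
    (congrArg₂ (· + ·) hP.symm (congrArg D (hA j).symm)) rfl)

/-- `J_r f` is the derivative of the mean curvature along the normal part of a field that
preserves the foliation. -/
theorem PreservedBy.opJ_eq_mvfderiv_meanCurvature [SecondCountableTopology M]
    (hVF : F.PreservedBy V) (hV : ContMDiff (𝓡 (n + 1)) (𝓡 (n + 1)).tangent ∞ (T% V))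
    (hN : F.IsUnitNormal N) (r : ℕ) (x : M) :
    F.opJ N r (fun y => inner ℝ (V y) (N y)) x
      = mvfderiv (𝓡 (n + 1)) (F.meanCurvature N (r + 1)) x (F.normalPart V x) := by
  let b := Module.finBasis ℝ (F.tangent x)
  obtain ⟨c, hc, hcX⟩ := hN.exists_shape_matrix b
  have hA : ∀ j, F.shape N x (b j) = ∑ i, c i j x • b i := by
    intro j
    ext1
    rw [hN.coe_shape, Submodule.coe_sum, ← hN.tangentExtend_self, hcX.self_of_nhds.1 j]
    exact Finset.sum_congr rfl fun i _ => congrArg (c i j x • ·) (hN.tangentExtend_self (b i))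
  have hcA : LinearMap.toMatrix b b (F.shape N x) = Matrix.of (fun i j => c i j x) := by
    ext i j
    rw [LinearMap.toMatrix_apply, hA, b.repr_sum_self]
    rfl
  obtain ⟨D, hD⟩ := hVF.exists_commutator hV hN b hc (hcX.mono fun y hy => hy.1) hA
  rw [opJ_eq_trace hN, hD, LinearMap.trace_comp_add_commutator (hN.commute_newton x r),
    hN.trace_newton_comp_toLin b hc hcA r,
    mvfderiv_congr (hcX.mono fun y hy => hy.2 (r + 1))]

end Jacobi

theorem mem_leaf_self {n : ℕ} {M : Type*} [TopologicalSpace M]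
    [ChartedSpace (EuclideanSpace ℝ (Fin (n + 1))) M] (F : CodimOneFoliation n M) (x : M) :
    x ∈ F.leaf x :=
  ⟨fun _ => x, ⟨continuous_const, fun _ _ _ _ => .of_forall fun _ => rfl⟩, rfl, rfl⟩

end CodimOneFoliation

theorem theoremt (n : ℕ) (M : Type*) [TopologicalSpace M] [T2Space M] [SecondCountableTopology M]
    [ChartedSpace (EuclideanSpace ℝ (Fin (n + 1))) M] [IsManifold (𝓡 (n + 1)) ∞ M]
    [RiemannianBundle (fun x : M => TangentSpace (𝓡 (n + 1)) x)]
    [IsContMDiffRiemannianBundle (𝓡 (n + 1)) ∞ (EuclideanSpace ℝ (Fin (n + 1)))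
      (fun x : M => TangentSpace (𝓡 (n + 1)) x)]
    (F : CodimOneFoliation n M)
    (N : Π x : M, TangentSpace (𝓡 (n + 1)) x) (hN : F.IsUnitNormal N)
    (r : ℕ)
    (hS : ∃ c : ℝ, ∀ L, F.IsLeaf L → ∀ x ∈ L, F.meanCurvature N (r + 1) x = c)
    (V : Π x : M, TangentSpace (𝓡 (n + 1)) x)
    (hV : ContMDiff (𝓡 (n + 1)) (𝓡 (n + 1)).tangent ∞ (T% V))
    (hVF : F.PreservedBy V) :
    F.IsJacobiField N r (F.normalPart V) := by
  obtain ⟨c, hc⟩ := hS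
  have hc' : ∀ x, F.meanCurvature N (r + 1) x = c := fun x =>
    hc _ ⟨x, rfl⟩ x (F.mem_leaf_self x)
  refine ⟨hN.contMDiff_normalPart hV, fun x => ?_, fun L _ x _ => ?_⟩
  · rw [hN.normalPart_eq]
    exact Submodule.smul_mem _ _ (hN.normal x)
  -- The coefficient of the normal part is again `f`, so the variation formula for `V` applies.
  · have h : (fun y => (inner ℝ (F.normalPart V y) (N y) : ℝ))
        = fun y => inner ℝ (V y) (N y) := by
      ext y
      rw [hN.normalPart_eq, Pi.smul_apply', inner_smul_left, hN.inner_self]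
      simp
    rw [CodimOneFoliation.normalJ, h, hVF.opJ_eq_mvfderiv_meanCurvature hV hN, funext hc',
      mvfderiv_const]
    exact zero_smul ℝ _
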